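/- Fix integers $n\ge 1$, $r\ge 0$, put $m=n+r(2n+1)$, and let $\sigma,\nu\in\mathbb R$ satisfy $\nu>0$ and $(2n+1)\sigma^2\ge 6(\nu+1)\log(2n+1)$. Consider the Klein–Gordon system $u_t=\pi$, $\pi_t=u_{xx}-u$, $2\pi$-periodic in $x$, for real trigonometric polynomials of degree at most $m$. Let $z=(q,p)\in\mathbb R^{2(2m+1)}$ be the coefficients of $(u,\pi)$ in the orthonormal basis $1/\sqrt{2\pi}$, $\cos(kx)/\sqrt\pi$, $\sin(kx)/\sqrt\pi$ ($1\le k\le m$) of this space. The system becomes $\dot z=Lz$ with $$L=\begin{pmatrix}0&I\\-\Lambda^2&0\end{pmatrix},\qquad A=\begin{pmatrix}\Lambda^2&0\\0&I\end{pmatrix},\qquad \Lambda^2=\operatorname{diag}(k^2+1),$$ where $k$ is the frequency of the basis function. The energy norm is $|(u,\pi)|_A^2=\int_0^{2\pi}\pi^2+u_x^2+u^2\,dx=z^{T}Az$, and $P$ is the Gaussian probability measure $dP=Z^{-1}e^{-\frac12 z^TAz}\,dz$. Let $g(x)=\frac1{\sqrt{2\pi}}\sum_{k\in\mathbb Z}e^{-k^2\sigma^2/4}\frac{e^{ikx}}{\sqrt{2\pi}}$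 and $x_\alpha=2\pi\alpha/(2n+1)$, $\alpha=0,\dots,2n$. The constraints are the $2(2n+1)$ numbers $v_{q,\alpha}=\int_0^{2\pi}g(x-x_\alpha)u(x,0)\,dx$ and $v_{p,\alpha}=\int_0^{2\pi}g(x-x_\alpha)\pi(x,0)\,dx$; write them as $G^Tz(0)=v_0$, with $G$ the corresponding real matrix. For given $v_0$, the exact mean $\langle(u(x,t),\pi(x,t))\rangle_{exact}$ is the average of all solutions with $G^Tz(0)=v_0$, taken with respect to the probability measure obtained by restricting $P$ to the affine subspace $\{z: G^Tz=v_0\}$ (density $e^{-\frac12 z^TAz}$ against its Lebesgue measure) and normalizing. The approximate mean $\langle(u(x,t),\pi(x,t))\rangle_{approx}$ is the pair of functions with coefficients $A^{-1}GM^{-1}v(t)$, where $M=G^TA^{-1}G$, $K=LA^{-1}$, and $\dot v=G^TKGM^{-1}v$, $v(0)=v_0$. Theorem. Let $t\ge 0$. If $z$ is drawn at random with respect to $P$ and $v_0=G^Tz$, then $$\left|\left\langle\binom{u(x,t)}{\pi(x,t)}\right\rangle_{exact}-\left\langle\binom{u(x,t)}{\pi(x,t)}\right\rangle_{approx}\right|_A\le\frac{2.3\,t}{(2n+1)^\nu}$$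 with probability greater than $1-(2n+1)^{-\nu}$. -/

import Mathlib

open Real MeasureTheory
open scoped Matrix ENNReal

namespace KleinGordon

noncomputable section

/-! ### Trigonometric polynomials and their real Fourier coefficients -/

/-- The `2m+1` real Fourier modes of degree at most `m`, indexed by `k = -m, …, m`. -/
abbrev Mode (m : ℕ) : Type := {k : ℤ // k ∈ Finset.Icc (-(m : ℤ)) (m : ℤ)}

/-- The `L²(0, 2π)`-orthonormal real trigonometric functions: `cos (|k| x) / √π` for `k < 0`,
`1 / √(2π)` for `k = 0`, and `sin (k x) / √π` for `k > 0`. -/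
def trig (k : ℤ) (x : ℝ) : ℝ :=
  if k < 0 then cos (k * x) / √π else if k = 0 then 1 / √(2 * π) else sin (k * x) / √π

/-- Phase space: the Fourier coefficients `(q, p)` of `(u, π)`.  The left summand holds the
coefficients `q` of `u`, the right summand the coefficients `p` of `π = u_t`. -/
abbrev Phase (m : ℕ) : Type := EuclideanSpace ℝ (Mode m ⊕ Mode m)

/-- A pair of real functions `(u, π)` on the line. -/
abbrev FieldPair : Type := (ℝ → ℝ) × (ℝ → ℝ)

/-- The pair of functions `(u, π)` with Fourier coefficients `z = (q, p)`. -/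
def toFields {m : ℕ} (z : Phase m) : FieldPair :=
  (fun x => ∑ k : Mode m, z (Sum.inl k) * trig k x,
   fun x => ∑ k : Mode m, z (Sum.inr k) * trig k x)

/-- The Hamiltonian `h = ½ ∫₀^{2π} π² + (u_x)² + u² dx`. -/
def hamiltonian (w : FieldPair) : ℝ :=
  (1 / 2) * ∫ x in (0 : ℝ)..(2 * π), ((w.2 x) ^ 2 + (deriv w.1 x) ^ 2 + (w.1 x) ^ 2)

/-- The energy norm `|·|_A`, whose square is twice the energy. -/
def energyNorm (w : FieldPair) : ℝ := √(2 * hamiltonian w)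

/-! ### The Klein–Gordon flow on trigonometric polynomials -/

/-- `Λ² = diag (ω_k²)` with `ω_k² = k² + 1`, the matrix of `-∂_x² + 1`. -/
def LambdaSq (m : ℕ) : Matrix (Mode m) (Mode m) ℝ :=
  Matrix.diagonal fun k => ((k : ℤ) : ℝ) ^ 2 + 1

/-- The generator `L` of the system `q' = p`, `p' = -Λ² q`. -/
def L (m : ℕ) : Matrix (Mode m ⊕ Mode m) (Mode m ⊕ Mode m) ℝ :=
  Matrix.fromBlocks 0 1 (-LambdaSq m) 0

/-- The energy matrix `A`, for which `h = ½ zᵀ A z`. -/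
def A (m : ℕ) : Matrix (Mode m ⊕ Mode m) (Mode m ⊕ Mode m) ℝ :=
  Matrix.fromBlocks (LambdaSq m) 0 0 1

/-- The solution `S(t) z = e^{tL} z` at time `t` with initial coefficients `z`. -/
def flow {m : ℕ} (t : ℝ) (z : Phase m) : Phase m :=
  WithLp.toLp 2 (NormedSpace.exp (t • L m) *ᵥ z.ofLp)

/-! ### The constraints -/

/-- The kernel `g(x) = (2π)^{-1/2} ∑_{k ∈ ℤ} e^{-k² σ² / 4} e^{ikx} / √(2π)`
(the sum of the series is real). -/
def kernel (σ x : ℝ) : ℝ :=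
  1 / √(2 * π) * (∑' k : ℤ, Complex.exp (-((k : ℂ) ^ 2 * (σ : ℂ) ^ 2 / 4)) *
    (Complex.exp (Complex.I * k * x) / (√(2 * π) : ℂ))).re

/-- The points `x_α = 2πα / (2n+1)`, `α = 0, …, 2n`. -/
def node (n : ℕ) (α : Fin (2 * n + 1)) : ℝ := 2 * π * (α : ℕ) / (2 * n + 1)

/-- The local average `∫₀^{2π} g(x - x_α) f(x) dx`. -/
def localAverage (n : ℕ) (σ : ℝ) (f : ℝ → ℝ) (α : Fin (2 * n + 1)) : ℝ :=
  ∫ x in (0 : ℝ)..(2 * π), kernel σ (x - node n α) * f x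

/-- Values of the constraints: `v_q` in the left summand, `v_p` in the right one. -/
abbrev Constraint (n : ℕ) : Type := Fin (2 * n + 1) ⊕ Fin (2 * n + 1) → ℝ

/-- The matrix whose transpose sends the Fourier coefficients of a function to its
local averages. -/
def G₀ (n m : ℕ) (σ : ℝ) : Matrix (Mode m) (Fin (2 * n + 1)) ℝ :=
  Matrix.of fun k α => localAverage n σ (trig k) α

/-- The constraint matrix `G = diag (G₀, G₀)`; the constraints are `Gᵀ z = v`. -/
def G (n m : ℕ) (σ : ℝ) :
    Matrix (Mode m ⊕ Mode m) (Fin (2 * n + 1) ⊕ Fin (2 * n + 1)) ℝ :=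
  Matrix.fromBlocks (G₀ n m σ) 0 0 (G₀ n m σ)

/-- The constraint values `v = Gᵀ z` of the initial data `z`. -/
def constraintOf (n : ℕ) {m : ℕ} (σ : ℝ) (z : Phase m) : Constraint n :=
  (G n m σ)ᵀ *ᵥ z.ofLp

/-! ### The invariant measure and its restriction to the constraint set -/

/-- A measure divided by its total mass. -/
def normalized {Ω : Type*} [MeasurableSpace Ω] (μ : Measure Ω) : Measure Ω :=
  (μ Set.univ)⁻¹ • μ

/-- The density `e^{-zᵀ A z / 2}`. -/
def gibbs {m : ℕ} (z : Phase m) : ℝ≥0∞ :=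
  ENNReal.ofReal (exp (-(1 / 2) * (z.ofLp ⬝ᵥ A m *ᵥ z.ofLp)))

/-- The invariant Gaussian measure `dP = Z⁻¹ e^{-zᵀ A z / 2} dz`. -/
def P (m : ℕ) : Measure (Phase m) :=
  normalized ((volume : Measure (Phase m)).withDensity gibbs)

/-- The affine subspace of all initial data with constraint values `v`. -/
def fiber (n m : ℕ) (σ : ℝ) (v : Constraint n) : Set (Phase m) :=
  {z | constraintOf n σ z = v}

/-- The dimension of the affine subspaces `Gᵀ z = v`. -/
def fiberDim (n m : ℕ) (σ : ℝ) : ℕ :=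
  Module.finrank ℝ (LinearMap.ker (Matrix.toLin' (G n m σ)ᵀ))

/-- The measure `P'`: `P` restricted to `Gᵀ z = v` (its density is integrated against the
Lebesgue surface measure of the affine subspace) and normalized again. -/
def restrictedP (n m : ℕ) (σ : ℝ) (v : Constraint n) : Measure (Phase m) :=
  normalized
    ((Measure.euclideanHausdorffMeasure (fiberDim n m σ)).restrict (fiber n m σ v) |>.withDensity gibbs)

/-! ### The exact mean and the approximate mean -/

/-- The exact mean at time `t`: the average over `P'` of `(u(x,t), π(x,t))`, taken over all
solutions whose initial data have constraint values `v`. -/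
def exactMean (n m : ℕ) (σ : ℝ) (v : Constraint n) (t : ℝ) : FieldPair :=
  (fun x => ∫ z, (toFields (flow t z)).1 x ∂(restrictedP n m σ v),
   fun x => ∫ z, (toFields (flow t z)).2 x ∂(restrictedP n m σ v))

/-- `M = Gᵀ A⁻¹ G`. -/
def M (n m : ℕ) (σ : ℝ) :
    Matrix (Fin (2 * n + 1) ⊕ Fin (2 * n + 1)) (Fin (2 * n + 1) ⊕ Fin (2 * n + 1)) ℝ :=
  (G n m σ)ᵀ * (A m)⁻¹ * G n m σ

/-- `K = L A⁻¹`. -/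
def K (m : ℕ) : Matrix (Mode m ⊕ Mode m) (Mode m ⊕ Mode m) ℝ := L m * (A m)⁻¹

/-- The matrix `Gᵀ K G M⁻¹` of the evolution equation for the constraints. -/
def constraintGenerator (n m : ℕ) (σ : ℝ) :
    Matrix (Fin (2 * n + 1) ⊕ Fin (2 * n + 1)) (Fin (2 * n + 1) ⊕ Fin (2 * n + 1)) ℝ :=
  (G n m σ)ᵀ * K m * G n m σ * (M n m σ)⁻¹

/-- The solution `v(t)` of `v' = Gᵀ K G M⁻¹ v`, `v(0) = v₀`. -/
def constraintFlow (n m : ℕ) (σ : ℝ) (v₀ : Constraint n) (t : ℝ) : Constraint n :=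
  NormedSpace.exp (t • constraintGenerator n m σ) *ᵥ v₀

/-- The mean `A⁻¹ G M⁻¹ v(t)` computed by the approximate method. -/
def approxMean (n m : ℕ) (σ : ℝ) (v₀ : Constraint n) (t : ℝ) : FieldPair :=
  toFields (m := m)
    (WithLp.toLp 2 (((A m)⁻¹ * G n m σ * (M n m σ)⁻¹) *ᵥ constraintFlow n m σ v₀ t))

/-! ### The two flows solve the equations that they are meant to solve -/

section Flows

attribute [local instance] Matrix.linftyOpNormedRing Matrix.linftyOpNormedAlgebra

theorem hasDerivAt_exp_mulVec {ι : Type*} [Fintype ι] [DecidableEq ι] (B : Matrix ι ι ℝ)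
    (v : ι → ℝ) (t : ℝ) :
    HasDerivAt (fun s : ℝ => NormedSpace.exp (s • B) *ᵥ v)
      (B *ᵥ (NormedSpace.exp (t • B) *ᵥ v)) t := by
  have h := hasDerivAt_exp_smul_const' (𝕂 := ℝ) B t
  have h2 := ((Matrix.mulVecBilin ℝ ℝ).flip v).toContinuousLinearMap.hasFDerivAt.comp_hasDerivAt t h
  rw [Matrix.mulVec_mulVec]
  exact h2

end Flows

theorem constraintFlow_solves (n m : ℕ) (σ : ℝ) (v₀ : Constraint n) :
    constraintFlow n m σ v₀ 0 = v₀ ∧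
      ∀ t, HasDerivAt (constraintFlow n m σ v₀)
        (constraintGenerator n m σ *ᵥ constraintFlow n m σ v₀ t) t :=
  ⟨by simp [constraintFlow], fun t => hasDerivAt_exp_mulVec _ _ t⟩

theorem hasDerivAt_trig (k : ℤ) (x : ℝ) : HasDerivAt (trig k)
    (if k < 0 then -(k * sin (k * x)) / √π else if k = 0 then 0 else k * cos (k * x) / √π) x := by
  have hl : HasDerivAt (fun y : ℝ => (k : ℝ) * y) (k : ℝ) x := by
    simpa using (hasDerivAt_id x).const_mul (k : ℝ)
  unfold trig
  split_ifs
  · exact ((hl.cos).div_const (√π)).congr_deriv (by ring)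
  · exact hasDerivAt_const x _
  · exact ((hl.sin).div_const (√π)).congr_deriv (by ring)

theorem hasDerivAt_deriv_trig (k : ℤ) (x : ℝ) :
    HasDerivAt (deriv (trig k)) (-(k : ℝ) ^ 2 * trig k x) x := by
  rw [show deriv (trig k) = _ from funext fun y => (hasDerivAt_trig k y).deriv]
  have hl : HasDerivAt (fun y : ℝ => (k : ℝ) * y) (k : ℝ) x := by
    simpa using (hasDerivAt_id x).const_mul (k : ℝ)
  unfold trig
  split_ifs with h1 h2
  · exact (((hl.sin.const_mul (k : ℝ)).neg).div_const (√π)).congr_deriv (by ring)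
  · subst h2; simpa using hasDerivAt_const x (0 : ℝ)
  · exact (((hl.cos.const_mul (k : ℝ))).div_const (√π)).congr_deriv (by ring)

theorem continuous_trig (k : ℤ) : Continuous (trig k) :=
  continuous_iff_continuousAt.2 fun x => (hasDerivAt_trig k x).continuousAt

theorem continuous_kernel {σ : ℝ} (hσ : σ ≠ 0) : Continuous (kernel σ) := by
  have hτ : 0 < (Complex.I * ((σ : ℂ) ^ 2 / (4 * π))).im := by
    have : Complex.I * ((σ : ℂ) ^ 2 / (4 * π)) = ((σ ^ 2 / (4 * π) : ℝ) : ℂ) * Complex.I := by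
      push_cast; ring
    rw [this, Complex.im_ofReal_mul, Complex.I_im, mul_one]
    positivity
  have hk : kernel σ = fun x : ℝ => 1 / √(2 * π) *
      (jacobiTheta₂ ((x : ℂ) / (2 * π)) (Complex.I * ((σ : ℂ) ^ 2 / (4 * π))) /
        (√(2 * π) : ℂ)).re := by
    ext x
    have hπ : (π : ℂ) ≠ 0 := by exact_mod_cast pi_ne_zero
    rw [kernel, jacobiTheta₂, ← tsum_div_const]
    congr 3
    ext k
    rw [jacobiTheta₂_term, ← mul_div_assoc, ← Complex.exp_add]
    congr 2
    field_simp
    linear_combination (-(k : ℂ) ^ 2 * (σ : ℂ) ^ 2) * Complex.I_sq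
  rw [hk]
  have hc : Continuous fun x : ℝ =>
      jacobiTheta₂ ((x : ℂ) / (2 * π)) (Complex.I * ((σ : ℂ) ^ 2 / (4 * π))) :=
    continuous_iff_continuousAt.2 fun x =>
      ContinuousAt.comp (f := fun x : ℝ => (x : ℂ) / (2 * π))
        (differentiableAt_jacobiTheta₂_fst _ hτ).continuousAt (by fun_prop)
  exact continuous_const.mul (Complex.continuous_re.comp (hc.div_const _))

/-- The constraints `Gᵀ z` of `z = (q, p)` are the local averages of `u` and of `π`. -/
theorem constraintOf_eq (n : ℕ) {m : ℕ} {σ : ℝ} (hσ : σ ≠ 0) (z : Phase m) :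
    constraintOf n σ z =
      Sum.elim (localAverage n σ (toFields z).1) (localAverage n σ (toFields z).2) := by
  have key : ∀ (c : Mode m → ℝ) (α : Fin (2 * n + 1)),
      localAverage n σ (fun x => ∑ k : Mode m, c k * trig k x) α =
        ∑ k : Mode m, localAverage n σ (trig k) α * c k := fun c α => by
    unfold localAverage
    simp_rw [Finset.mul_sum]
    rw [intervalIntegral.integral_finsetSum]
    · refine Finset.sum_congr rfl fun k _ => ?_
      rw [← intervalIntegral.integral_mul_const]
      congr 1; ext x; ring
    · intro k _
      exact (((continuous_kernel hσ).comp (continuous_id.sub continuous_const)).mul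
        (continuous_const.mul (continuous_trig k))).intervalIntegrable _ _
  unfold constraintOf G
  rw [Matrix.fromBlocks_transpose, Matrix.fromBlocks_mulVec]
  simp only [Matrix.transpose_zero, Matrix.zero_mulVec, add_zero, zero_add]
  congr 1 <;> ext α
  · exact (key (fun k => z (Sum.inl k)) α).symm
  · exact (key (fun k => z (Sum.inr k)) α).symm

/-- The fields `(u, π)` of `S(t) z` solve `u_t = π`, `π_t = u_xx - u` with the prescribed
initial data. -/
theorem flow_solves {m : ℕ} (z : Phase m) :
    toFields (flow 0 z) = toFields z ∧ ∀ t x : ℝ,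
      HasDerivAt (fun s => (toFields (flow s z)).1 x) ((toFields (flow t z)).2 x) t ∧
      HasDerivAt (fun s => (toFields (flow s z)).2 x)
        (deriv (deriv (toFields (flow t z)).1) x - (toFields (flow t z)).1 x) t := by
  refine ⟨by simp [flow], fun t x => ?_⟩
  have hz := hasDerivAt_pi.1 (hasDerivAt_exp_mulVec (L m) z.ofLp t)
  have hL1 : ∀ (w : Mode m ⊕ Mode m → ℝ) k, (L m *ᵥ w) (Sum.inl k) = w (Sum.inr k) :=
    fun w k => by simp [L, Matrix.fromBlocks_mulVec]
  have hL2 : ∀ (w : Mode m ⊕ Mode m → ℝ) k,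
      (L m *ᵥ w) (Sum.inr k) = -((((k : ℤ) : ℝ) ^ 2 + 1) * w (Sum.inl k)) :=
    fun w k => by
      rw [L, Matrix.fromBlocks_mulVec]
      simp [LambdaSq, Matrix.mulVec_diagonal]
      ring
  have hd : ∀ w : Phase m, deriv (toFields w).1 =
      fun y => ∑ k : Mode m, w (Sum.inl k) * deriv (trig k) y := fun w => funext fun y =>
    (HasDerivAt.fun_sum (u := Finset.univ) fun (k : Mode m) _ =>
      ((hasDerivAt_trig k y).differentiableAt.hasDerivAt.const_mul (w (Sum.inl k)))).deriv
  have hdd : ∀ w : Phase m, deriv (deriv (toFields w).1) x =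
      ∑ k : Mode m, w (Sum.inl k) * (-((k : ℤ) : ℝ) ^ 2 * trig k x) := fun w => by
    rw [hd w]
    exact (HasDerivAt.fun_sum (u := Finset.univ) fun (k : Mode m) _ =>
      ((hasDerivAt_deriv_trig k x).const_mul (w (Sum.inl k)))).deriv
  constructor
  · have h := HasDerivAt.fun_sum (u := Finset.univ) fun (k : Mode m) _ =>
      (hz (Sum.inl k)).mul_const (trig k x)
    refine h.congr_deriv ?_
    refine Finset.sum_congr rfl fun k _ => ?_
    rw [hL1]
    rfl
  · have h := HasDerivAt.fun_sum (u := Finset.univ) fun (k : Mode m) _ =>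
      (hz (Sum.inr k)).mul_const (trig k x)
    refine h.congr_deriv ?_
    rw [hdd]
    simp only [toFields]
    rw [← Finset.sum_sub_distrib]
    refine Finset.sum_congr rfl fun k _ => ?_
    rw [hL2]
    simp only [flow]
    ring

end

end KleinGordon

/-! Put `B = A⁻¹GM⁻¹` (`reconstruct`). Since `Bv` is `A`-orthogonal to `ker Gᵀ`, the Gaussian on the
fiber `Gᵀz = v` is centred at `Bv`, so the exact mean is `e^{tL}Bv` (`exactMean_eq`). The
approximate mean `y(t)` solves `y' = BGᵀLy`, `y(0) = Bv`. Here `BGᵀ` is the `A`-orthogonal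
projection onto the range of `A⁻¹G`, so this is the Galerkin approximation of `ż = Lz` in that
space. Because `L` is skew for the energy inner product, both evolutions conserve energy, and the
error is at most `t` times the largest residual `|Ly - BGᵀLy|_A` (`galerkin_error`).

The residual is the distance from `Ly` to the range of `A⁻¹G`. In Fourier space `G` samples the
modes at the nodes and multiplies by `gam`. The `2n+1` lowest modes are orthogonal on the nodes, so
a suitable `c` cancels the residual in all frequencies up to `n`. A higher frequency `k` coincides
at the nodes with a multiple of a low one `j`, where `k² - j² = (2n+1)e`, and there `gam² ` is
smaller by the factor `exp(-(2n+1)σ²/2)^e`. The assumption on `σ` bounds the base by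
`(2n+1)^{-3(ν+1)}`, and summing geometrically gives `exists_residual_le`.

The energy of `Bv₀` is random, with expectation `tr(M⁻¹M) = 2(2n+1)`. Markov's inequality keeps it
below `3(2n+1)^{1+ν}` outside an event of probability less than `(2n+1)^{-ν}`, and the remaining
powers of `2n+1` give the constant `2.3`. -/

namespace KleinGordon

noncomputable section

/-! ### Derivatives of vector-valued curves -/

section Curves

variable {ι κ : Type*} [Fintype ι]

theorem hasDerivAt_mulVec [Finite κ] (C : Matrix κ ι ℝ) {p : ℝ → ι → ℝ} {p' : ι → ℝ} {t : ℝ}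
    (hp : HasDerivAt p p' t) : HasDerivAt (fun s => C *ᵥ p s) (C *ᵥ p') t := by
  have := Fintype.ofFinite κ
  refine hasDerivAt_pi.2 fun k => ?_
  exact HasDerivAt.fun_sum fun i _ => ((hasDerivAt_pi.1 hp i).const_mul (C k i))

theorem hasDerivAt_dotProduct {p q : ℝ → ι → ℝ} {p' q' : ι → ℝ} {t : ℝ}
    (hp : HasDerivAt p p' t) (hq : HasDerivAt q q' t) :
    HasDerivAt (fun s => p s ⬝ᵥ q s) (p' ⬝ᵥ q t + p t ⬝ᵥ q') t := by
  have h := HasDerivAt.fun_sum (u := Finset.univ) fun i _ =>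
    (hasDerivAt_pi.1 hp i).mul (hasDerivAt_pi.1 hq i)
  refine h.congr_deriv ?_
  simp [dotProduct, Finset.sum_add_distrib]

theorem dotProduct_mulVec_comm {A : Matrix ι ι ℝ} (hA : Aᵀ = A) (z w : ι → ℝ) :
    z ⬝ᵥ A *ᵥ w = w ⬝ᵥ A *ᵥ z := by
  rw [Matrix.dotProduct_mulVec, ← Matrix.mulVec_transpose, hA, dotProduct_comm]

/-- Cauchy–Schwarz for a semidefinite form, from the discriminant of the energy of `x • z + w` as a
quadratic in `x`. -/
theorem dotProduct_mulVec_sq_le {A : Matrix ι ι ℝ} (hA : Aᵀ = A)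
    (hpos : ∀ z, 0 ≤ z ⬝ᵥ A *ᵥ z) (z w : ι → ℝ) :
    (z ⬝ᵥ A *ᵥ w) ^ 2 ≤ (z ⬝ᵥ A *ᵥ z) * (w ⬝ᵥ A *ᵥ w) := by
  have h : ∀ x : ℝ, 0 ≤ (z ⬝ᵥ A *ᵥ z) * (x * x) + (2 * (z ⬝ᵥ A *ᵥ w)) * x + w ⬝ᵥ A *ᵥ w := by
    intro x
    have := hpos (x • z + w)
    simp only [Matrix.mulVec_add, Matrix.mulVec_smul, dotProduct_add, add_dotProduct,
      smul_dotProduct, dotProduct_smul, smul_eq_mul, dotProduct_mulVec_comm hA w z] at this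
    linarith
  have := discrim_le_zero h
  rw [discrim] at this
  linarith

theorem dotProduct_skew {A L : Matrix ι ι ℝ} (hL : A * L = -(Lᵀ * A)) (z w : ι → ℝ) :
    z ⬝ᵥ A *ᵥ (L *ᵥ w) = -((L *ᵥ z) ⬝ᵥ A *ᵥ w) := by
  rw [Matrix.mulVec_mulVec, hL, Matrix.neg_mulVec, dotProduct_neg, ← Matrix.mulVec_mulVec,
    Matrix.mulVec_transpose, dotProduct_comm, ← Matrix.dotProduct_mulVec, dotProduct_comm]

end Curves

/-! ### The Galerkin approximation of a conservative linear system -/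

section Galerkin

variable {ι κ : Type*} [Fintype ι] [Fintype κ] [DecidableEq ι] [DecidableEq κ]
  {A L : Matrix ι ι ℝ} {G : Matrix ι κ ℝ}

/-- Solutions of a conservative system preserve the energy inner product. -/
theorem dotProduct_exp_exp (hL : A * L = -(Lᵀ * A)) (z w : ι → ℝ) (t : ℝ) :
    (NormedSpace.exp (t • L) *ᵥ z) ⬝ᵥ A *ᵥ (NormedSpace.exp (t • L) *ᵥ w) = z ⬝ᵥ A *ᵥ w := by
  have hd : ∀ s : ℝ, HasDerivAt (fun s : ℝ =>
      (NormedSpace.exp (s • L) *ᵥ z) ⬝ᵥ A *ᵥ (NormedSpace.exp (s • L) *ᵥ w)) 0 s := fun s => by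
    refine (hasDerivAt_dotProduct (hasDerivAt_exp_mulVec L z s)
      (hasDerivAt_mulVec A (hasDerivAt_exp_mulVec L w s))).congr_deriv ?_
    rw [dotProduct_skew hL]
    ring
  have := is_const_of_deriv_eq_zero (fun s => (hd s).differentiableAt) (fun s => (hd s).deriv) t 0
  simpa using this

/-- The reconstruction `A⁻¹ G M⁻¹` of a state from its constraint values. -/
def reconstruct (A : Matrix ι ι ℝ) (G : Matrix ι κ ℝ) : Matrix ι κ ℝ :=
  A⁻¹ * G * (Gᵀ * A⁻¹ * G)⁻¹

theorem transpose_mul_reconstruct (hM : IsUnit (Gᵀ * A⁻¹ * G).det) :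
    Gᵀ * reconstruct A G = 1 := by
  rw [reconstruct, ← Matrix.mul_assoc, ← Matrix.mul_assoc, Matrix.mul_nonsing_inv _ hM]

theorem mul_reconstruct (hAu : IsUnit A.det) :
    A * reconstruct A G = G * (Gᵀ * A⁻¹ * G)⁻¹ := by
  rw [reconstruct, ← Matrix.mul_assoc, ← Matrix.mul_assoc, Matrix.mul_nonsing_inv _ hAu,
    Matrix.one_mul]

theorem reconstruct_transpose_mul (hA : Aᵀ = A) (hAu : IsUnit A.det) :
    (reconstruct A G)ᵀ * A = (Gᵀ * A⁻¹ * G)⁻¹ * Gᵀ := by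
  have h : (A * reconstruct A G)ᵀ = (G * (Gᵀ * A⁻¹ * G)⁻¹)ᵀ := by rw [mul_reconstruct hAu]
  rw [Matrix.transpose_mul, Matrix.transpose_mul, hA, Matrix.transpose_nonsing_inv] at h
  rw [h]
  congr 2
  simp [Matrix.transpose_mul, Matrix.transpose_nonsing_inv, hA, Matrix.mul_assoc]

/-- A reconstructed state pairs with `x` only through `Gᵀx`, hence is `A`-orthogonal to `ker Gᵀ`.
This gives Pythagoras for the residual, energy conservation for the Galerkin flow, and the centre of
the Gaussian on a fiber. -/
theorem reconstruct_dotProduct (hA : Aᵀ = A) (hAu : IsUnit A.det) (v : κ → ℝ) (x : ι → ℝ) :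
    (reconstruct A G *ᵥ v) ⬝ᵥ A *ᵥ x = v ⬝ᵥ (Gᵀ * A⁻¹ * G)⁻¹ *ᵥ (Gᵀ *ᵥ x) := by
  rw [Matrix.mulVec_mulVec, ← reconstruct_transpose_mul hA hAu, ← Matrix.mulVec_mulVec,
    Matrix.dotProduct_mulVec v, Matrix.vecMul_transpose]

/-- The energy of the part of a vector that is invisible to the constraints is at most the energy
of the vector modulo the reconstructed states. -/
theorem residual_le (hA : Aᵀ = A) (hpos : ∀ z, 0 ≤ z ⬝ᵥ A *ᵥ z) (hAu : IsUnit A.det)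
    (hM : IsUnit (Gᵀ * A⁻¹ * G).det) (x : ι → ℝ) (c : κ → ℝ) :
    (x - reconstruct A G *ᵥ (Gᵀ *ᵥ x)) ⬝ᵥ A *ᵥ (x - reconstruct A G *ᵥ (Gᵀ *ᵥ x)) ≤
      (x - A⁻¹ *ᵥ (G *ᵥ c)) ⬝ᵥ A *ᵥ (x - A⁻¹ *ᵥ (G *ᵥ c)) := by
  set r := x - reconstruct A G *ᵥ (Gᵀ *ᵥ x) with hr
  have hGr : Gᵀ *ᵥ r = 0 := by
    rw [hr, Matrix.mulVec_sub, Matrix.mulVec_mulVec, transpose_mul_reconstruct hM,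
      Matrix.one_mulVec, sub_self]
  -- The competitor is itself a reconstructed state, so it differs from the projection of `x` by
  -- some `y` orthogonal to `r`.
  have hc : A⁻¹ *ᵥ (G *ᵥ c) = reconstruct A G *ᵥ ((Gᵀ * A⁻¹ * G) *ᵥ c) := by
    rw [Matrix.mulVec_mulVec, Matrix.mulVec_mulVec, reconstruct, Matrix.mul_assoc _ _ (Gᵀ * _ * _),
      Matrix.nonsing_inv_mul _ hM, Matrix.mul_one]
  set y := reconstruct A G *ᵥ (Gᵀ *ᵥ x - (Gᵀ * A⁻¹ * G) *ᵥ c) with hy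
  have hx : x - A⁻¹ *ᵥ (G *ᵥ c) = y + r := by
    rw [hc, hy, hr, Matrix.mulVec_sub]
    abel
  have h0 : y ⬝ᵥ A *ᵥ r = 0 := by
    rw [hy, reconstruct_dotProduct hA hAu, hGr, Matrix.mulVec_zero, dotProduct_zero]
  rw [hx, Matrix.mulVec_add, add_dotProduct, dotProduct_add, dotProduct_add,
    dotProduct_mulVec_comm hA r y, h0]
  linarith [hpos y]

/-- Error bound for the Galerkin approximation: the exact evolution of a reconstructed state and
its projected evolution drift apart at a rate given by the size of the residual. -/
theorem galerkin_error (hA : Aᵀ = A) (hpos : ∀ z, 0 ≤ z ⬝ᵥ A *ᵥ z) (hAu : IsUnit A.det)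
    (hM : IsUnit (Gᵀ * A⁻¹ * G).det) (hL : A * L = -(Lᵀ * A)) {δ : ℝ} (hδ : 0 ≤ δ)
    (hres : ∀ b : κ → ℝ, ∃ c : κ → ℝ,
      (L *ᵥ (A⁻¹ *ᵥ (G *ᵥ b)) - A⁻¹ *ᵥ (G *ᵥ c)) ⬝ᵥ
          A *ᵥ (L *ᵥ (A⁻¹ *ᵥ (G *ᵥ b)) - A⁻¹ *ᵥ (G *ᵥ c)) ≤
        δ ^ 2 * ((A⁻¹ *ᵥ (G *ᵥ b)) ⬝ᵥ A *ᵥ (A⁻¹ *ᵥ (G *ᵥ b))))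
    (v : κ → ℝ) {t : ℝ} (ht : 0 ≤ t) :
    let e := NormedSpace.exp (t • L) *ᵥ (reconstruct A G *ᵥ v) - reconstruct A G *ᵥ
      (NormedSpace.exp (t • (Gᵀ * (L * A⁻¹) * G * (Gᵀ * A⁻¹ * G)⁻¹)) *ᵥ v)
    √(e ⬝ᵥ A *ᵥ e) ≤ t * δ *
      √((reconstruct A G *ᵥ v) ⬝ᵥ A *ᵥ (reconstruct A G *ᵥ v)) := by
  set B := reconstruct A G with hB
  set C := Gᵀ * (L * A⁻¹) * G * (Gᵀ * A⁻¹ * G)⁻¹ with hC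
  have hCB : C = Gᵀ * L * B := by simp only [hC, hB, reconstruct, Matrix.mul_assoc]
  set y : ℝ → ι → ℝ := fun s => B *ᵥ (NormedSpace.exp (s • C) *ᵥ v) with hy
  have hy' : ∀ s, HasDerivAt y (B *ᵥ (Gᵀ *ᵥ (L *ᵥ y s))) s := fun s => by
    refine (hasDerivAt_mulVec B (hasDerivAt_exp_mulVec C v s)).congr_deriv ?_
    rw [hy, hCB]
    simp only [Matrix.mulVec_mulVec, Matrix.mul_assoc]
  have hy0 : y 0 = B *ᵥ v := by simp [hy]
  have henergy : ∀ s, y s ⬝ᵥ A *ᵥ y s = (B *ᵥ v) ⬝ᵥ A *ᵥ (B *ᵥ v) := by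
    have hd : ∀ s : ℝ, HasDerivAt (fun s : ℝ => y s ⬝ᵥ A *ᵥ y s) 0 s := fun s => by
      refine (hasDerivAt_dotProduct (hy' s) (hasDerivAt_mulVec A (hy' s))).congr_deriv ?_
      -- The projection `BGᵀ` is `A`-self-adjoint and fixes `y s`; what remains vanishes by
      -- skewness.
      have h1 : y s ⬝ᵥ A *ᵥ (B *ᵥ (Gᵀ *ᵥ (L *ᵥ y s))) = y s ⬝ᵥ A *ᵥ (L *ᵥ y s) := by
        conv_lhs => rw [hy]
        conv_rhs => rw [hy]
        rw [reconstruct_dotProduct hA hAu, reconstruct_dotProduct hA hAu, Matrix.mulVec_mulVec _ Gᵀ B,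
          transpose_mul_reconstruct hM, Matrix.one_mulVec]
      rw [dotProduct_mulVec_comm hA _ (y s), h1]
      have h2 := dotProduct_skew hL (y s) (y s)
      rw [dotProduct_mulVec_comm hA (L *ᵥ y s) (y s)] at h2
      linarith
    intro s
    have := is_const_of_deriv_eq_zero (fun s => (hd s).differentiableAt) (fun s => (hd s).deriv) s 0
    rw [this, hy0]
  intro e
  have hr : ∀ s, (L *ᵥ y s - B *ᵥ (Gᵀ *ᵥ (L *ᵥ y s))) ⬝ᵥ
      A *ᵥ (L *ᵥ y s - B *ᵥ (Gᵀ *ᵥ (L *ᵥ y s))) ≤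
        δ ^ 2 * ((B *ᵥ v) ⬝ᵥ A *ᵥ (B *ᵥ v)) := fun s => by
    obtain ⟨c, hc⟩ := hres ((Gᵀ * A⁻¹ * G)⁻¹ *ᵥ (NormedSpace.exp (s • C) *ᵥ v))
    have hys : A⁻¹ *ᵥ (G *ᵥ ((Gᵀ * A⁻¹ * G)⁻¹ *ᵥ (NormedSpace.exp (s • C) *ᵥ v))) = y s := by
      rw [hy, hB, reconstruct]
      simp only [Matrix.mulVec_mulVec, Matrix.mul_assoc]
    rw [hys, henergy] at hc
    exact (residual_le hA hpos hAu hM _ c).trans hc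
  -- `p` is the exact solution that equals `e` at time `t`. When it is paired with `y`, skewness
  -- cancels the exact flow from the derivative and leaves only the residual, while the energy of
  -- `p` stays that of `e`.
  set p : ℝ → ι → ℝ := fun s => NormedSpace.exp (s • L) *ᵥ (NormedSpace.exp ((-t) • L) *ᵥ e) with hp
  have hp' : ∀ s, HasDerivAt p (L *ᵥ p s) s := fun s => hasDerivAt_exp_mulVec L _ s
  have hpe : ∀ s, p s ⬝ᵥ A *ᵥ p s = e ⬝ᵥ A *ᵥ e := fun s => by
    rw [hp, dotProduct_exp_exp hL, dotProduct_exp_exp hL]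
  have hpt : p t = e := by
    rw [hp]
    simp only [Matrix.mulVec_mulVec]
    rw [← Matrix.exp_add_of_commute _ _ (((Commute.refl L).smul_left t).smul_right (-t)), ← add_smul,
      add_neg_cancel, zero_smul, NormedSpace.exp_zero, Matrix.one_mulVec]
  have hφ : ∀ s, HasDerivAt (fun s => p s ⬝ᵥ A *ᵥ y s)
      (-(p s ⬝ᵥ A *ᵥ (L *ᵥ y s - B *ᵥ (Gᵀ *ᵥ (L *ᵥ y s))))) s := fun s => by
    refine (hasDerivAt_dotProduct (hp' s) (hasDerivAt_mulVec A (hy' s))).congr_deriv ?_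
    have := dotProduct_skew hL (p s) (y s)
    rw [Matrix.mulVec_sub, dotProduct_sub, this]
    ring
  have hbound := Convex.norm_image_sub_le_of_norm_hasDerivWithin_le (𝕜 := ℝ) (s := Set.univ)
    (C := √(e ⬝ᵥ A *ᵥ e) * (δ * √((B *ᵥ v) ⬝ᵥ A *ᵥ (B *ᵥ v))))
    (fun s _ => (hφ s).hasDerivWithinAt) (fun s _ => by
      rw [norm_neg, Real.norm_eq_abs]
      refine abs_le_of_sq_le_sq ((dotProduct_mulVec_sq_le hA hpos _ _).trans ?_) (by positivity)
      rw [hpe, mul_pow, mul_pow, sq_sqrt (hpos _), sq_sqrt (hpos _)]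
      exact mul_le_mul_of_nonneg_left (hr s) (hpos _)) convex_univ
      (Set.mem_univ 0) (Set.mem_univ t)
  -- Transporting the pairing at time `0` by the flow turns `y 0` into the exact solution at time
  -- `t`, so the increment pairs `e` with `-e`. Dividing by the norm of `e` then gives the bound.
  have hend : p t ⬝ᵥ A *ᵥ y t - p 0 ⬝ᵥ A *ᵥ y 0 = -(e ⬝ᵥ A *ᵥ e) := by
    have h0 : p 0 ⬝ᵥ A *ᵥ y 0 = e ⬝ᵥ A *ᵥ (NormedSpace.exp (t • L) *ᵥ (B *ᵥ v)) := by
      rw [← dotProduct_exp_exp hL (p 0) (y 0) t, hy0]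
      congr 1
      rw [← hpt, hp]
      simp
    rw [h0, hpt, ← dotProduct_sub, ← Matrix.mulVec_sub, ← dotProduct_neg, ← Matrix.mulVec_neg]
    congr 2
    simp [e, hy]
  rw [hend, norm_neg, sub_zero, Real.norm_eq_abs, Real.norm_eq_abs, abs_of_nonneg ht,
    abs_of_nonneg (hpos _)] at hbound
  rcases (Real.sqrt_nonneg (e ⬝ᵥ A *ᵥ e)).eq_or_lt with h0 | h0
  · rw [← h0]
    positivity
  · refine le_of_mul_le_mul_left ?_ h0
    rw [Real.mul_self_sqrt (hpos _)]
    linarith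

end Galerkin

/-! ### Orthogonality of the trigonometric functions -/

/-- The amplitude of `trig k`. -/
def amplitude (k : ℤ) : ℝ := if k = 0 then 1 / √(2 * π) else 1 / √π

/-- The phase of `trig k` as a cosine of frequency `k`. -/
def phase (k : ℤ) : ℝ := if 0 < k then -(π / 2) else 0

/-- Treating every mode as a shifted cosine lets one product formula replace the case distinctions
on signs. -/
theorem trig_eq (k : ℤ) (x : ℝ) : trig k x = amplitude k * cos (k * x + phase k) := by
  unfold trig amplitude phase
  rcases lt_trichotomy k 0 with h | h | h
  · simp only [h, h.ne, h.not_gt, if_true, if_false, add_zero]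
    ring
  · simp [h]
  · simp only [h, h.ne', h.not_gt, if_true, if_false]
    rw [← sub_eq_add_neg, cos_sub_pi_div_two]
    ring

theorem abs_trig_le (k : ℤ) (x : ℝ) : |trig k x| ≤ amplitude k := by
  have : 0 ≤ amplitude k := by unfold amplitude; split_ifs <;> positivity
  rw [trig_eq, abs_mul, abs_of_nonneg this]
  exact mul_le_of_le_one_right this (abs_cos_le_one _)

theorem trig_mul_trig (j k : ℤ) (x : ℝ) :
    trig j x * trig k x = amplitude j * amplitude k / 2 *
      (cos ((j + k : ℤ) * x + (phase j + phase k)) +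
        cos ((j - k : ℤ) * x + (phase j - phase k))) := by
  have h1 : ((j + k : ℤ) : ℝ) * x + (phase j + phase k) = (j * x + phase j) + (k * x + phase k) := by
    push_cast; ring
  have h2 : ((j - k : ℤ) : ℝ) * x + (phase j - phase k) = (j * x + phase j) - (k * x + phase k) := by
    push_cast; ring
  rw [trig_eq, trig_eq, h1, h2, cos_add (j * x + phase j), cos_sub (j * x + phase j)]
  ring

/-- The mean value of a product of two modes, used both for integrals and for sums over nodes. For
`j = -k ≠ 0` the phases add up to `-π/2`, which kills the cosine; for `j = k = 0` both terms count,
which the smaller amplitude compensates. -/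
theorem amplitude_phase_orthogonality (j k : ℤ) :
    amplitude j * amplitude k / 2 *
      ((if j + k = 0 then cos (phase j + phase k) else 0) +
        (if j - k = 0 then cos (phase j - phase k) else 0)) =
      if j = k then 1 / (2 * π) else 0 := by
  have hp : (√π) ^ 2 = π := sq_sqrt pi_pos.le
  have hp2 : (√(2 * π)) ^ 2 = 2 * π := sq_sqrt (by positivity)
  by_cases hjk : j = k
  · subst hjk
    by_cases h0 : j = 0
    · subst h0
      simp only [amplitude, phase]
      norm_num
      field_simp
      rw [sq_sqrt two_pos.le, hp]
    · have : j + j ≠ 0 := by omega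
      simp only [amplitude, h0, this, if_false, sub_self, if_true, cos_zero]
      field_simp
      rw [hp]
      ring
  · have h1 : j - k ≠ 0 := sub_ne_zero.2 hjk
    simp only [h1, hjk, if_false, add_zero]
    split_ifs with h2
    · have : phase j + phase k = -(π / 2) := by
        unfold phase
        split_ifs <;> first | omega | ring
      rw [this, cos_neg, cos_pi_div_two, mul_zero]
    · simp

theorem integral_cos_int_mul_add (k : ℤ) (c : ℝ) :
    ∫ x in (0 : ℝ)..(2 * π), cos (k * x + c) = 2 * π * if k = 0 then cos c else 0 := by
  split_ifs with hk
  · simp [hk]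
  · have hk' : (k : ℝ) ≠ 0 := by exact_mod_cast hk
    rw [intervalIntegral.integral_comp_mul_add (fun x => cos x) hk', integral_cos,
      show (k : ℝ) * (2 * π) + c = c + k * (2 * π) by ring, sin_add_int_mul_two_pi]
    simp

theorem integral_trig_mul_trig (j k : ℤ) :
    ∫ x in (0 : ℝ)..(2 * π), trig j x * trig k x = if j = k then 1 else 0 := by
  simp_rw [trig_mul_trig]
  rw [intervalIntegral.integral_const_mul, intervalIntegral.integral_add
    (Continuous.intervalIntegrable (by fun_prop) _ _)
    (Continuous.intervalIntegrable (by fun_prop) _ _),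
    integral_cos_int_mul_add, integral_cos_int_mul_add, ← mul_add, mul_left_comm,
    amplitude_phase_orthogonality]
  split_ifs
  · field_simp
  · simp

/-- Parseval's identity. -/
theorem integral_sum_trig_sq {ι : Type*} [Fintype ι] {e : ι → ℤ} (he : Function.Injective e)
    (c : ι → ℝ) :
    ∫ x in (0 : ℝ)..(2 * π), (∑ i, c i * trig (e i) x) ^ 2 = ∑ i, c i ^ 2 := by
  have h : ∀ x, (∑ i, c i * trig (e i) x) ^ 2 =
      ∑ i, ∑ j, c i * c j * (trig (e i) x * trig (e j) x) := fun x => by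
    rw [sq, Finset.sum_mul_sum]
    exact Finset.sum_congr rfl fun i _ => Finset.sum_congr rfl fun j _ => by ring
  have hc : ∀ i j, Continuous fun x => c i * c j * (trig (e i) x * trig (e j) x) := fun i j =>
    continuous_const.mul ((continuous_trig _).mul (continuous_trig _))
  simp_rw [h]
  rw [intervalIntegral.integral_finsetSum fun i _ =>
    (continuous_finsetSum _ fun j _ => hc i j).intervalIntegrable _ _]
  refine Finset.sum_congr rfl fun i _ => ?_
  rw [intervalIntegral.integral_finsetSum fun j _ => (hc i j).intervalIntegrable _ _]
  classical
  simp only [intervalIntegral.integral_const_mul, integral_trig_mul_trig, he.eq_iff]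
  simp [sq]

/-- Differentiation permutes the modes up to factors, so Parseval also computes the integral of
`u_x²`. -/
theorem deriv_trig (k : ℤ) : deriv (trig k) = fun x => (k : ℝ) * trig (-k) x := by
  ext x
  rw [(hasDerivAt_trig k x).deriv]
  unfold trig
  rcases lt_trichotomy k 0 with h | h | h
  · have h1 : ¬ -k < 0 := by omega
    have h2 : ¬ -k = 0 := by omega
    simp only [h, h1, h2, if_true, if_false, Int.cast_neg, neg_mul, sin_neg]
    ring
  · simp [h]
  · have h1 : -k < 0 := by omega
    simp only [h.ne', h.not_gt, h1, if_true, if_false, Int.cast_neg, neg_mul, cos_neg]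
    ring

theorem toFields_sub {m : ℕ} (z w : Phase m) : toFields (z - w) = toFields z - toFields w := by
  ext x <;> simp [toFields, sub_mul]

theorem dotProduct_A_mulVec {m : ℕ} (z w : Mode m ⊕ Mode m → ℝ) :
    z ⬝ᵥ A m *ᵥ w = (∑ k : Mode m, (((k : ℤ) : ℝ) ^ 2 + 1) * (z (Sum.inl k) * w (Sum.inl k))) +
      ∑ k : Mode m, z (Sum.inr k) * w (Sum.inr k) := by
  rw [A, Matrix.fromBlocks_mulVec, dotProduct, Fintype.sum_sum_type]
  simp only [Sum.elim_inl, Sum.elim_inr, Matrix.zero_mulVec, Matrix.one_mulVec, add_zero, zero_add,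
    LambdaSq, Matrix.mulVec_diagonal, Function.comp]
  congr 1
  exact Finset.sum_congr rfl fun k _ => by ring

/-- The energy norm in terms of the Fourier coefficients. -/
theorem energyNorm_toFields {m : ℕ} (z : Phase m) :
    energyNorm (toFields z) = √(z.ofLp ⬝ᵥ A m *ᵥ z.ofLp) := by
  have hd : ∀ x, deriv (toFields z).1 x =
      ∑ k : Mode m, (z (Sum.inl k) * ((k : ℤ) : ℝ)) * trig (-k) x := fun x => by
    refine (HasDerivAt.fun_sum (u := Finset.univ) fun (k : Mode m) _ =>
      ((hasDerivAt_trig k x).differentiableAt.hasDerivAt.const_mul (z (Sum.inl k)))).deriv.trans ?_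
    refine Finset.sum_congr rfl fun k _ => ?_
    rw [deriv_trig]
    ring
  have hc : ∀ (e : Mode m → ℤ) (c : Mode m → ℝ),
      IntervalIntegrable (fun x => (∑ k, c k * trig (e k) x) ^ 2) volume 0 (2 * π) := fun e c =>
    ((continuous_finsetSum _ fun k _ => continuous_const.mul (continuous_trig _)).pow
      2).intervalIntegrable _ _
  unfold energyNorm hamiltonian
  simp_rw [hd]
  simp only [toFields]
  rw [intervalIntegral.integral_add ((hc _ _).add (hc _ _)) (hc _ _),
    intervalIntegral.integral_add (hc _ _) (hc _ _),
    integral_sum_trig_sq Subtype.val_injective, integral_sum_trig_sq Subtype.val_injective,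
    integral_sum_trig_sq (e := fun k : Mode m => -(k : ℤ))
      (neg_injective.comp Subtype.val_injective), dotProduct_A_mulVec]
  congr 1
  rw [← mul_assoc, mul_one_div_cancel two_ne_zero, one_mul, add_assoc, ← Finset.sum_add_distrib,
    add_comm]
  congr 1 <;> exact Finset.sum_congr rfl fun k _ => by ring

/-! ### The local averages of the trigonometric functions -/

/-- The Fourier coefficients of the kernel. -/
def gam (σ : ℝ) (k : ℤ) : ℝ := exp (-((k : ℝ) ^ 2 * σ ^ 2 / 4))

theorem gam_pos (σ : ℝ) (k : ℤ) : 0 < gam σ k := exp_pos _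

theorem gam_neg (σ : ℝ) (k : ℤ) : gam σ (-k) = gam σ k := by simp [gam]

/-- These are the norms of the terms of the Jacobi theta series at `z = 0`, `τ = iσ²/(4π)`. -/
theorem summable_gam {σ : ℝ} (hσ : σ ≠ 0) : Summable (gam σ) := by
  have hτ : 0 < (Complex.I * ((σ : ℂ) ^ 2 / (4 * π))).im := by
    have : Complex.I * ((σ : ℂ) ^ 2 / (4 * π)) = ((σ ^ 2 / (4 * π) : ℝ) : ℂ) * Complex.I := by
      push_cast; ring
    rw [this, Complex.im_ofReal_mul, Complex.I_im, mul_one]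
    positivity
  have h := ((summable_jacobiTheta₂_term_iff 0 _).2 hτ).norm
  refine h.congr fun k => ?_
  rw [jacobiTheta₂_term, Complex.norm_exp, gam]
  congr 1
  have : 2 * (π : ℂ) * Complex.I * k * 0 + π * Complex.I * (k : ℂ) ^ 2 *
      (Complex.I * ((σ : ℂ) ^ 2 / (4 * π))) = ((-((k : ℝ) ^ 2 * σ ^ 2 / 4) : ℝ) : ℂ) := by
    have hπ : (π : ℂ) ≠ 0 := by exact_mod_cast pi_ne_zero
    push_cast
    field_simp
    linear_combination ((k : ℂ) ^ 2 * (σ : ℂ) ^ 2) * Complex.I_sq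
  rw [this, Complex.ofReal_re]

theorem hasSum_kernel {σ : ℝ} (hσ : σ ≠ 0) (x : ℝ) :
    HasSum (fun k : ℤ => 1 / (2 * π) * (gam σ k * cos (k * x))) (kernel σ x) := by
  have hre : ∀ k : ℤ, Complex.exp (-((k : ℂ) ^ 2 * (σ : ℂ) ^ 2 / 4)) *
      (Complex.exp (Complex.I * k * x) / (√(2 * π) : ℂ)) =
      ((gam σ k / √(2 * π) : ℝ) : ℂ) * Complex.exp ((k * x : ℝ) * Complex.I) := fun k => by
    rw [gam]
    push_cast
    rw [show Complex.I * k * x = k * x * Complex.I by ring]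
    ring
  have hs : Summable fun k : ℤ => Complex.exp (-((k : ℂ) ^ 2 * (σ : ℂ) ^ 2 / 4)) *
      (Complex.exp (Complex.I * k * x) / (√(2 * π) : ℂ)) := by
    refine Summable.of_norm_bounded ((summable_gam hσ).div_const (√(2 * π))) fun k => ?_
    rw [hre, norm_mul, Complex.norm_exp_ofReal_mul_I, mul_one, Complex.norm_real, Real.norm_eq_abs,
      abs_of_nonneg (div_nonneg (gam_pos σ k).le (sqrt_nonneg _))]
  have h := (Complex.hasSum_re hs.hasSum).mul_left (1 / √(2 * π))
  refine h.congr_fun fun k => ?_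
  rw [hre, Complex.re_ofReal_mul, Complex.exp_ofReal_mul_I_re]
  have : 1 / (2 * π) = 1 / √(2 * π) * (1 / √(2 * π)) := by
    rw [one_div_mul_one_div, mul_self_sqrt (by positivity)]
  rw [this]
  ring

theorem integral_cos_mul_trig (j k : ℤ) (a : ℝ) :
    ∫ x in (0 : ℝ)..(2 * π), cos (j * (x - a)) * trig k x =
      π * ((if j + k = 0 then trig k a else 0) + if j - k = 0 then trig k a else 0) := by
  have h : ∀ x, cos (j * (x - a)) * trig k x = amplitude k / 2 *
      (cos ((j + k : ℤ) * x + (-(j * a) + phase k)) +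
        cos ((j - k : ℤ) * x + (-(j * a) - phase k))) := fun x => by
    have h1 : ((j + k : ℤ) : ℝ) * x + (-(j * a) + phase k) =
      j * (x - a) + (k * x + phase k) := by push_cast; ring
    have h2 : ((j - k : ℤ) : ℝ) * x + (-(j * a) - phase k) =
      j * (x - a) - (k * x + phase k) := by push_cast; ring
    rw [trig_eq, h1, h2, cos_add (j * (x - a)), cos_sub (j * (x - a))]
    ring
  simp_rw [h]
  rw [intervalIntegral.integral_const_mul, intervalIntegral.integral_add
    (Continuous.intervalIntegrable (by fun_prop) _ _)
    (Continuous.intervalIntegrable (by fun_prop) _ _),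
    integral_cos_int_mul_add, integral_cos_int_mul_add, trig_eq]
  have e1 : (if j + k = 0 then cos (-(j * a) + phase k) else 0) =
      if j + k = 0 then cos (k * a + phase k) else 0 := by
    split_ifs with h1
    · rw [show j = -k by omega]; push_cast; ring_nf
    · rfl
  have e2 : (if j - k = 0 then cos (-(j * a) - phase k) else 0) =
      if j - k = 0 then cos (k * a + phase k) else 0 := by
    split_ifs with h1
    · rw [show j = k by omega, ← cos_neg]; ring_nf
    · rfl
  rw [e1, e2]
  split_ifs <;> ring

/-- The kernel acts on the trigonometric functions as a Fourier multiplier. -/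
theorem localAverage_trig (n : ℕ) {σ : ℝ} (hσ : σ ≠ 0) (k : ℤ) (α : Fin (2 * n + 1)) :
    localAverage n σ (trig k) α = gam σ k * trig k (node n α) := by
  set a := node n α
  have hsum : HasSum (fun j : ℤ => ∫ x in (0 : ℝ)..(2 * π),
      1 / (2 * π) * (gam σ j * cos (j * (x - a))) * trig k x) (localAverage n σ (trig k) α) := by
    refine intervalIntegral.hasSum_integral_of_dominated_convergence
      (fun j _ => 1 / (2 * π) * gam σ j * amplitude k) (fun j => ?_) (fun j => ?_) ?_ ?_ ?_
    · exact Continuous.aestronglyMeasurable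
        (Continuous.mul (by fun_prop) (continuous_trig k))
    · refine Filter.Eventually.of_forall fun x _ => ?_
      rw [norm_mul, Real.norm_eq_abs, Real.norm_eq_abs]
      refine mul_le_mul ?_ (abs_trig_le k x) (abs_nonneg _)
        (mul_nonneg (by positivity) (gam_pos σ j).le)
      rw [abs_mul, abs_mul, abs_of_pos (gam_pos σ j), abs_of_nonneg (by positivity : 0 ≤ 1 / (2 * π))]
      exact mul_le_mul_of_nonneg_left
        (mul_le_of_le_one_right (gam_pos σ j).le (abs_cos_le_one _)) (by positivity)
    · exact Filter.Eventually.of_forall fun x _ => ((summable_gam hσ).mul_left _).mul_right _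
    · exact intervalIntegrable_const
    · exact Filter.Eventually.of_forall fun x _ => (hasSum_kernel hσ (x - a)).mul_right _
  -- Each of `j = k` and `j = -k` contributes one half; for `k = 0` both halves fall on the same
  -- index, so no separate case is needed.
  have hval : ∀ j : ℤ, ∫ x in (0 : ℝ)..(2 * π),
      1 / (2 * π) * (gam σ j * cos (j * (x - a))) * trig k x =
      (if j = -k then gam σ k * trig k a / 2 else 0) +
        if j = k then gam σ k * trig k a / 2 else 0 := fun j => by
    have : ∀ x, 1 / (2 * π) * (gam σ j * cos (j * (x - a))) * trig k x =
      gam σ j / (2 * π) * (cos (j * (x - a)) * trig k x) := fun x => by ring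
    simp_rw [this]
    rw [intervalIntegral.integral_const_mul, integral_cos_mul_trig, ← mul_assoc,
      show gam σ j / (2 * π) * π = gam σ j / 2 by field_simp, mul_add]
    congr 1
    · simp only [← eq_neg_iff_add_eq_zero]
      split_ifs with h
      · rw [h, gam_neg]; ring
      · simp
    · simp only [sub_eq_zero]
      split_ifs with h
      · rw [h]; ring
      · simp
  simp_rw [hval] at hsum
  refine hsum.unique ?_
  have h := (hasSum_ite_eq (-k) (gam σ k * trig k a / 2)).add
    (hasSum_ite_eq k (gam σ k * trig k a / 2))
  rwa [add_halves] at h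

/-! ### Discrete orthogonality and aliasing -/

/-- The sum is the real part of a geometric sum in a `(2n+1)`-th root of unity, which equals `1`
exactly when `2n+1` divides `k`. -/
theorem sum_cos_node (n : ℕ) (k : ℤ) (c : ℝ) :
    ∑ α : Fin (2 * n + 1), cos (k * node n α + c) =
      (2 * n + 1) * if (2 * (n : ℤ) + 1) ∣ k then cos c else 0 := by
  have hN : ((2 * n + 1 : ℕ) : ℂ) ≠ 0 := Nat.cast_ne_zero.2 (by omega)
  set ω : ℂ := Complex.exp (2 * π * Complex.I * (k / (2 * n + 1 : ℕ))) with hω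
  have hterm : ∀ α : Fin (2 * n + 1), cos (k * node n α + c) =
      (Complex.exp (c * Complex.I) * ω ^ (α : ℕ)).re := fun α => by
    rw [hω, ← Complex.exp_nat_mul, ← Complex.exp_add, ← Complex.exp_ofReal_mul_I_re]
    congr 2
    rw [node]
    push_cast
    field_simp
    ring
  have hpow : ω ^ (2 * n + 1) = 1 := by
    rw [hω, ← Complex.exp_nat_mul, Complex.exp_eq_one_iff]
    refine ⟨k, ?_⟩
    field_simp
  simp_rw [hterm]
  rw [← Complex.re_sum, ← Finset.mul_sum, Fin.sum_univ_eq_sum_range (fun i => ω ^ i)]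
  have hone : ω = 1 ↔ (2 * n + 1 : ℤ) ∣ k := by
    rw [hω, Complex.exp_eq_one_iff]
    constructor
    · rintro ⟨l, hl⟩
      refine ⟨l, ?_⟩
      have h2 : (2 * π * Complex.I : ℂ) ≠ 0 := Complex.two_pi_I_ne_zero
      rw [mul_comm (l : ℂ)] at hl
      have h3 := mul_left_cancel₀ h2 hl
      rw [div_eq_iff hN] at h3
      have : (k : ℂ) = ((2 * n + 1) * l : ℤ) := by rw [h3]; push_cast; ring
      exact_mod_cast this
    · rintro ⟨l, rfl⟩
      refine ⟨l, ?_⟩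
      push_cast at hN ⊢
      field_simp
  split_ifs with hk
  · rw [hone.2 hk]
    simp only [one_pow, Finset.sum_const, Finset.card_range, nsmul_eq_mul, mul_one]
    rw [mul_comm, ← Complex.ofReal_natCast, Complex.re_ofReal_mul, Complex.exp_ofReal_mul_I_re]
    push_cast
    ring
  · rw [geom_sum_eq (mt hone.1 hk), hpow]
    simp

/-- Since `|j ± k| ≤ 2n`, divisibility by `2n+1` means vanishing, and the sum behaves like the
integral. -/
theorem sum_trig_mul_trig_node (n : ℕ) {j k : ℤ} (hj : |j| ≤ n) (hk : |k| ≤ n) :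
    ∑ α, trig j (node n α) * trig k (node n α) =
      if j = k then (2 * n + 1 : ℝ) / (2 * π) else 0 := by
  have hd : ∀ l : ℤ, |l| ≤ 2 * n → ((2 * n + 1 : ℤ) ∣ l ↔ l = 0) := fun l hl =>
    ⟨fun h => Int.eq_zero_of_abs_lt_dvd h (by omega), fun h => h ▸ dvd_zero _⟩
  rw [abs_le] at hj hk
  simp_rw [trig_mul_trig]
  rw [← Finset.mul_sum, Finset.sum_add_distrib, sum_cos_node, sum_cos_node, ← mul_add, mul_left_comm]
  simp only [hd (j + k) (abs_le.2 (by omega)), hd (j - k) (abs_le.2 (by omega))]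
  rw [amplitude_phase_orthogonality]
  split_ifs
  · ring
  · simp

/-- The values of the `2n+1` lowest trigonometric functions at the nodes. -/
def nodeMatrix (n : ℕ) : Matrix (Mode n) (Fin (2 * n + 1)) ℝ :=
  Matrix.of fun k α => trig k (node n α)

theorem nodeMatrix_mul_transpose (n : ℕ) :
    nodeMatrix n * ((2 * π / (2 * n + 1) : ℝ) • (nodeMatrix n)ᵀ) = 1 := by
  ext j k
  have hj := Finset.mem_Icc.1 j.2
  have hk := Finset.mem_Icc.1 k.2
  rw [Matrix.mul_smul, Matrix.smul_apply, Matrix.mul_apply]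
  simp only [nodeMatrix, Matrix.of_apply, Matrix.transpose_apply]
  rw [sum_trig_mul_trig_node n (abs_le.2 hj) (abs_le.2 hk), Matrix.one_apply]
  simp only [Subtype.ext_iff]
  split_ifs
  · have : (2 * n + 1 : ℝ) ≠ 0 := by positivity
    rw [smul_eq_mul]
    field_simp
  · simp

theorem nodeMatrix_transpose_mul (n : ℕ) :
    ((2 * π / (2 * n + 1) : ℝ) • (nodeMatrix n)ᵀ) * nodeMatrix n = 1 := by
  refine (Matrix.mul_eq_one_comm_of_card_eq _ _ _ ?_).1 (nodeMatrix_mul_transpose n)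
  rw [Fintype.card_coe, Int.card_Icc, Fintype.card_fin]
  omega

/-- At the nodes every trigonometric function of degree larger than `n` is a multiple of one of
degree at most `n`. -/
theorem exists_alias (n : ℕ) {k : ℤ} (hk : n < k.natAbs) :
    ∃ j : ℤ, |j| ≤ n ∧ ∃ θ : ℝ, θ ^ 2 ≤ 2 ∧
      (∀ α, trig k (node n α) = θ * trig j (node n α)) ∧
      ∃ e : ℕ, k ^ 2 - j ^ 2 = (2 * n + 1) * e ∧ k.natAbs - n ≤ e := by
  set N : ℤ := 2 * n + 1 with hN
  -- Division with centred remainder; the alias has frequency `|s|`, and `e = l(lN + 2s)`.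
  obtain ⟨l, s, hls, hl, hs1, hs2⟩ : ∃ l s : ℤ, (k.natAbs : ℤ) = l * N + s ∧ 1 ≤ l ∧
      -(n : ℤ) ≤ s ∧ s ≤ n := by
    have hNpos : 0 < N := by omega
    have h1 := Int.emod_add_mul_ediv ((k.natAbs : ℤ) + n) N
    have h2 := Int.emod_nonneg ((k.natAbs : ℤ) + n) hNpos.ne'
    have h3 := Int.emod_lt_of_pos ((k.natAbs : ℤ) + n) hNpos
    refine ⟨((k.natAbs : ℤ) + n) / N, k.natAbs - ((k.natAbs : ℤ) + n) / N * N, by ring, ?_, ?_, ?_⟩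
    · exact (Int.le_ediv_iff_mul_le hNpos).2 (by omega)
    · rw [mul_comm]; omega
    · rw [mul_comm]; omega
  have harg : ∀ α, ((k.natAbs : ℤ) : ℝ) * node n α =
      s * node n α + ((l * (α : ℕ) : ℤ) : ℝ) * (2 * π) := fun α => by
    rw [hls, hN, node]
    push_cast
    have : (2 * n + 1 : ℝ) ≠ 0 := by positivity
    field_simp
    ring
  have hcos : ∀ α, cos (((k.natAbs : ℤ) : ℝ) * node n α) = cos (s * node n α) := fun α => by
    rw [harg, cos_add_int_mul_two_pi]
  have hsin : ∀ α, sin (((k.natAbs : ℤ) : ℝ) * node n α) = sin (s * node n α) := fun α => by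
    rw [harg, sin_add_int_mul_two_pi]
  have hksq : k ^ 2 = (l * N + s) ^ 2 := by rw [← hls, Int.natAbs_sq]
  -- The difference of the two sides increases with `s`, and at `s = -n` it equals `(l - 1)(lN -
  -- 2n)`.
  have he0 : (k.natAbs : ℤ) - n ≤ l * (l * N + 2 * s) := by
    have : 0 ≤ (l - 1) * (l * N - 2 * n) :=
      mul_nonneg (by omega) (by nlinarith)
    rw [hls]
    nlinarith
  have he : ∀ j : ℤ, j ^ 2 = s ^ 2 → ∃ e : ℕ, k ^ 2 - j ^ 2 = N * e ∧ k.natAbs - n ≤ e :=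
    fun j hj => by
    refine ⟨(l * (l * N + 2 * s)).toNat, ?_, by omega⟩
    rw [Int.toNat_of_nonneg (by omega), hksq, hj]
    ring
  rcases lt_trichotomy k 0 with h | h | h
  · have hk' : (k : ℝ) = -((k.natAbs : ℤ) : ℝ) := by
      rw [Int.natCast_natAbs, abs_of_neg h]; simp
    have htk : ∀ α, trig k (node n α) = cos (s * node n α) / √π := fun α => by
      rw [trig, if_pos h, hk', neg_mul, cos_neg, hcos]
    rcases lt_trichotomy s 0 with h' | h' | h'
    · exact ⟨s, abs_le.2 ⟨hs1, hs2⟩, 1, by norm_num, fun α => by rw [htk, trig, if_pos h', one_mul],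
        he s rfl⟩
    -- A cosine aliased to the constant mode meets the amplitude `1/√(2π)` in place of `1/√π`; this
    -- is the only case with `θ² = 2`.
    · refine ⟨0, by simp, √2, by simp, fun α => ?_, he 0 (by rw [h'])⟩
      rw [htk, h', trig, if_neg (lt_irrefl _), if_pos rfl, sqrt_mul two_pos.le]
      simp only [Int.cast_zero, zero_mul, cos_zero]
      have : √2 ≠ 0 := by positivity
      field_simp
    · refine ⟨-s, abs_le.2 ⟨by omega, by omega⟩, 1, by norm_num, fun α => ?_, he (-s) (by ring)⟩
      rw [htk, trig, if_pos (by omega), one_mul, Int.cast_neg, neg_mul, cos_neg]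
  · simp [h] at hk
  · have hk' : (k : ℝ) = ((k.natAbs : ℤ) : ℝ) := by
      rw [Int.natCast_natAbs, abs_of_pos h]
    have htk : ∀ α, trig k (node n α) = sin (s * node n α) / √π := fun α => by
      rw [trig, if_neg h.not_gt, if_neg h.ne', hk', hsin]
    rcases lt_trichotomy s 0 with h' | h' | h'
    · refine ⟨-s, abs_le.2 ⟨by omega, by omega⟩, -1, by norm_num, fun α => ?_, he (-s) (by ring)⟩
      rw [htk, trig, if_neg (by omega), if_neg (by omega), Int.cast_neg, neg_mul (s : ℝ), sin_neg]
      ring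
    -- A sine whose frequency is a multiple of `2n+1` vanishes at all nodes.
    · refine ⟨0, by simp, 0, by norm_num, fun α => ?_, he 0 (by rw [h'])⟩
      rw [htk, h']
      simp
    · refine ⟨s, abs_le.2 ⟨hs1, hs2⟩, 1, by norm_num, fun α => ?_, he s rfl⟩
      rw [htk, trig, if_neg h'.not_gt, if_neg h'.ne', one_mul]

/-! ### The matrices of the approximate method -/

theorem A_eq_diagonal (m : ℕ) : A m = Matrix.diagonal
    (Sum.elim (fun k : Mode m => ((k : ℤ) : ℝ) ^ 2 + 1) (fun _ => 1)) := by
  rw [A, LambdaSq, ← Matrix.diagonal_one, Matrix.fromBlocks_diagonal]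

theorem A_inv (m : ℕ) : (A m)⁻¹ = Matrix.diagonal
    (Sum.elim (fun k : Mode m => (((k : ℤ) : ℝ) ^ 2 + 1)⁻¹) (fun _ => 1)) := by
  refine Matrix.inv_eq_right_inv ?_
  rw [A_eq_diagonal, Matrix.diagonal_mul_diagonal, ← Matrix.diagonal_one]
  congr 1
  ext (k | k)
  · simp only [Sum.elim_inl]
    exact mul_inv_cancel₀ (by positivity)
  · simp

theorem A_posDef (m : ℕ) : (A m).PosDef := by
  rw [A_eq_diagonal, Matrix.posDef_diagonal_iff]
  rintro (k | k)
  · simp only [Sum.elim_inl]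
    positivity
  · simp

theorem A_transpose (m : ℕ) : (A m)ᵀ = A m := by
  rw [A_eq_diagonal, Matrix.diagonal_transpose]

theorem A_nonneg {m : ℕ} (z : Mode m ⊕ Mode m → ℝ) : 0 ≤ z ⬝ᵥ A m *ᵥ z := by
  rw [dotProduct_A_mulVec]
  exact add_nonneg (Finset.sum_nonneg fun k _ => mul_nonneg (by positivity) (mul_self_nonneg _))
    (Finset.sum_nonneg fun k _ => mul_self_nonneg _)

theorem A_mul_L (m : ℕ) : A m * L m = -((L m)ᵀ * A m) := by
  have : (LambdaSq m)ᵀ = LambdaSq m := Matrix.diagonal_transpose _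
  rw [A, L, Matrix.fromBlocks_transpose, Matrix.fromBlocks_multiply, Matrix.fromBlocks_multiply,
    Matrix.fromBlocks_neg]
  simp [this]

theorem G₀_mulVec (n m : ℕ) {σ : ℝ} (hσ : σ ≠ 0) (b : Fin (2 * n + 1) → ℝ) (k : Mode m) :
    (G₀ n m σ *ᵥ b) k = gam σ k * ∑ α, trig k (node n α) * b α := by
  rw [Matrix.mulVec, dotProduct, Finset.mul_sum]
  refine Finset.sum_congr rfl fun α _ => ?_
  rw [G₀, Matrix.of_apply, localAverage_trig n hσ, mul_assoc]

/-- The inclusion of the modes of degree at most `n` into those of degree at most `m`. -/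
def Mode.castLE {n m : ℕ} (h : n ≤ m) (k : Mode n) : Mode m :=
  ⟨k, Finset.Icc_subset_Icc (by omega) (by omega) k.2⟩

/-- The modes of degree at most `n` already determine `b`: `gam` never vanishes and `nodeMatrix` is
invertible. Hence `M` is positive definite. -/
theorem G₀_injective {n m : ℕ} (h : n ≤ m) {σ : ℝ} (hσ : σ ≠ 0) :
    Function.Injective (G₀ n m σ).mulVec := by
  refine (injective_iff_map_eq_zero (G₀ n m σ).mulVecLin).2 fun b hb => ?_
  have hT : nodeMatrix n *ᵥ b = 0 := by
    ext k
    have h1 := congrFun hb (k.castLE h)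
    rw [Matrix.mulVecLin_apply, G₀_mulVec n m hσ] at h1
    exact (mul_eq_zero.1 h1).resolve_left (gam_pos _ _).ne'
  rw [← Matrix.one_mulVec b, ← nodeMatrix_transpose_mul, ← Matrix.mulVec_mulVec, hT,
    Matrix.mulVec_zero]

theorem G_mulVec (n m : ℕ) (σ : ℝ) (b : Constraint n) : G n m σ *ᵥ b =
    Sum.elim (G₀ n m σ *ᵥ (b ∘ Sum.inl)) (G₀ n m σ *ᵥ (b ∘ Sum.inr)) := by
  rw [G, Matrix.fromBlocks_mulVec]
  simp

theorem G_injective {n m : ℕ} (h : n ≤ m) {σ : ℝ} (hσ : σ ≠ 0) :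
    Function.Injective (G n m σ).mulVec := by
  intro b c hbc
  simp only [G_mulVec] at hbc
  ext (α | α)
  · exact congrFun (G₀_injective h hσ (funext fun k => congrFun hbc (Sum.inl k))) α
  · exact congrFun (G₀_injective h hσ (funext fun k => congrFun hbc (Sum.inr k))) α

theorem isUnit_det_M {n m : ℕ} (h : n ≤ m) {σ : ℝ} (hσ : σ ≠ 0) :
    IsUnit ((G n m σ)ᵀ * (A m)⁻¹ * G n m σ).det := by
  have := (A_posDef m).inv.conjTranspose_mul_mul_same (G_injective h hσ)
  rw [Matrix.conjTranspose_eq_transpose_of_trivial] at this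
  exact this.det_pos.ne'.isUnit

/-! ### The residual of the approximate method -/

theorem sum_geometric_Icc_le (n d : ℕ) {ρ : ℝ} (h0 : 0 ≤ ρ) (h1 : ρ < 1) :
    ∑ k ∈ Finset.Icc (-((n + d : ℕ) : ℤ)) ((n + d : ℕ) : ℤ),
      (if n < k.natAbs then ρ ^ (k.natAbs - n - 1) else 0) ≤ 2 * (1 - ρ)⁻¹ := by
  have h : ∑ k ∈ Finset.Icc (-((n + d : ℕ) : ℤ)) ((n + d : ℕ) : ℤ),
      (if n < k.natAbs then ρ ^ (k.natAbs - n - 1) else 0) = 2 * ∑ i ∈ Finset.range d, ρ ^ i := by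
    induction d with
    | zero =>
      rw [Finset.sum_eq_zero]
      · simp
      · intro k hk
        rw [Finset.mem_Icc] at hk
        rw [if_neg (by omega)]
    | succ d ih =>
      have : Finset.Icc (-((n + (d + 1) : ℕ) : ℤ)) ((n + (d + 1) : ℕ) : ℤ) =
          insert ((n + d : ℕ) + 1 : ℤ) (insert (-((n + d : ℕ) + 1 : ℤ))
            (Finset.Icc (-((n + d : ℕ) : ℤ)) ((n + d : ℕ) : ℤ))) := by
        ext k
        simp only [Finset.mem_insert, Finset.mem_Icc]
        omega
      rw [this, Finset.sum_insert, Finset.sum_insert, ih, Finset.sum_range_succ, if_pos (by omega),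
        if_pos (by omega), show ((n + d : ℕ) + 1 : ℤ).natAbs - n - 1 = d by omega,
        show (-((n + d : ℕ) + 1 : ℤ)).natAbs - n - 1 = d by omega]
      · ring
      · rw [Finset.mem_Icc]; omega
      · rw [Finset.mem_insert, Finset.mem_Icc]; omega
  rw [h, ← tsum_geometric_of_lt_one h0 h1]
  exact mul_le_mul_of_nonneg_left
    ((summable_geometric_of_lt_one h0 h1).sum_le_tsum _ fun i _ => pow_nonneg h0 i) two_pos.le

/-- The factor `e ≤ 2^(e-1)` is absorbed by doubling the ratio to `2ρ ≤ 2/27`; one factor `ρ` is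
kept as the small parameter. -/
theorem mul_pow_le_geometric {ρ : ℝ} (h0 : 0 ≤ ρ) (h1 : ρ ≤ 1 / 27) {i e : ℕ} (hi : 1 ≤ i)
    (hie : i ≤ e) : e * ρ ^ e ≤ ρ * (2 / 27) ^ (i - 1) := by
  obtain ⟨d, rfl⟩ : ∃ d, e = d + 1 := ⟨e - 1, by omega⟩
  have h2 : ((d + 1 : ℕ) : ℝ) ≤ 2 ^ d := by exact_mod_cast Nat.lt_two_pow_self
  calc ((d + 1 : ℕ) : ℝ) * ρ ^ (d + 1) ≤ 2 ^ d * ρ ^ (d + 1) := by gcongr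
    _ = ρ * (2 * ρ) ^ d := by rw [mul_pow]; ring
    _ ≤ ρ * (2 / 27) ^ d := by gcongr; linarith
    _ ≤ ρ * (2 / 27) ^ (i - 1) := by
      gcongr ρ * ?_
      exact pow_le_pow_of_le_one (by norm_num) (by norm_num) (by omega)

/-- With `D = k² - j² = (2n+1)e`, the frequency weights combine to `D²/(k²+1) ≤ D`, and `gam σ k ^
2` is `gam σ j ^ 2` times the `e`-th power of the exponential in `hρ`. -/
theorem alias_term_le {n : ℕ} {σ ρ : ℝ} (hρ0 : 0 ≤ ρ) (hρ : exp (-((2 * n + 1) * σ ^ 2 / 2)) ≤ ρ)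
    (hρ1 : ρ ≤ 1 / 27) {k j : ℤ} (hk : n < k.natAbs) {θ X : ℝ} (hθ : θ ^ 2 ≤ 2) {e : ℕ}
    (he : k ^ 2 - j ^ 2 = (2 * n + 1) * e) (hke : k.natAbs - n ≤ e) :
    ((k : ℝ) ^ 2 + 1) * (gam σ k * (θ * X) -
        ((k : ℝ) ^ 2 + 1)⁻¹ * (gam σ k * (θ * (((j : ℝ) ^ 2 + 1) * X)))) ^ 2 ≤
      2 * (2 * n + 1) * ρ * (2 / 27) ^ (k.natAbs - n - 1) * (gam σ j * X) ^ 2 := by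
  have heR : (k : ℝ) ^ 2 - (j : ℝ) ^ 2 = (2 * n + 1) * e := by exact_mod_cast he
  set D : ℝ := (2 * n + 1) * e with hD
  have hD0 : 0 ≤ D := by positivity
  have hk1 : 0 < (k : ℝ) ^ 2 + 1 := by positivity
  have hg : gam σ k ^ 2 = gam σ j ^ 2 * exp (-((2 * n + 1) * σ ^ 2 / 2)) ^ e := by
    rw [gam, gam, ← exp_nat_mul, ← exp_nat_mul, ← exp_nat_mul, ← exp_add]
    congr 1
    push_cast
    linear_combination (-σ ^ 2 / 2) * heR
  have h1 : ((k : ℝ) ^ 2 + 1) * (gam σ k * (θ * X) -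
        ((k : ℝ) ^ 2 + 1)⁻¹ * (gam σ k * (θ * (((j : ℝ) ^ 2 + 1) * X)))) ^ 2 =
      gam σ k ^ 2 * (θ ^ 2 * X ^ 2) * (D * (D / ((k : ℝ) ^ 2 + 1))) := by
    rw [← heR]
    field_simp
    ring
  have h2 : D / ((k : ℝ) ^ 2 + 1) ≤ 1 := by
    rw [div_le_one hk1, ← heR]
    nlinarith [sq_nonneg (j : ℝ)]
  rw [h1, hg]
  calc gam σ j ^ 2 * exp (-((2 * n + 1) * σ ^ 2 / 2)) ^ e * (θ ^ 2 * X ^ 2) *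
        (D * (D / ((k : ℝ) ^ 2 + 1)))
      ≤ gam σ j ^ 2 * ρ ^ e * (2 * X ^ 2) * (D * 1) := by gcongr
    _ = 2 * (2 * n + 1) * (e * ρ ^ e) * (gam σ j * X) ^ 2 := by rw [hD]; ring
    _ ≤ 2 * (2 * n + 1) * (ρ * (2 / 27) ^ (k.natAbs - n - 1)) * (gam σ j * X) ^ 2 := by
      gcongr ?_ * ?_ * ?_
      exact mul_pow_le_geometric hρ0 hρ1 (by omega) hke
    _ = _ := by ring

theorem sq_le_sum_mode {m : ℕ} (f : ℤ → ℝ) {j : ℤ} (hj : |j| ≤ m) :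
    f j ^ 2 ≤ ∑ k : Mode m, f k ^ 2 :=
  Finset.single_le_sum (f := fun k : Mode m => f k ^ 2) (fun _ _ => sq_nonneg _)
    (Finset.mem_univ (⟨j, Finset.mem_Icc.2 (abs_le.1 hj)⟩ : Mode m))

/-- By `hbc` the terms with `|k| ≤ n` vanish. In each other term the alias is bounded by the whole
sum `S`, leaving a geometric series over both signs of `k`: `4.32 = 2 · 2 / (1 - 2/27)`. -/
theorem sum_alias_le {n m : ℕ} (h : n ≤ m) {σ ρ : ℝ} (hρ0 : 0 ≤ ρ)
    (hρ : exp (-((2 * n + 1) * σ ^ 2 / 2)) ≤ ρ) (hρ1 : ρ ≤ 1 / 27) (b c : Fin (2 * n + 1) → ℝ)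
    (hbc : ∀ j : ℤ, |j| ≤ n → ∑ α, trig j (node n α) * c α =
      ((j : ℝ) ^ 2 + 1) * ∑ α, trig j (node n α) * b α) :
    ∑ k : Mode m, (((k : ℤ) : ℝ) ^ 2 + 1) * (gam σ k * ∑ α, trig k (node n α) * b α -
        (((k : ℤ) : ℝ) ^ 2 + 1)⁻¹ * (gam σ k * ∑ α, trig k (node n α) * c α)) ^ 2 ≤
      4.32 * ((2 * n + 1) * ρ) * ∑ k : Mode m, (gam σ k * ∑ α, trig k (node n α) * b α) ^ 2 := by
  generalize hS : ∑ k : Mode m, (gam σ k * ∑ α, trig k (node n α) * b α) ^ 2 = S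
  have hS0 : 0 ≤ S := hS ▸ Finset.sum_nonneg fun k _ => sq_nonneg _
  have hterm : ∀ k : ℤ, ((k : ℝ) ^ 2 + 1) * (gam σ k * ∑ α, trig k (node n α) * b α -
        ((k : ℝ) ^ 2 + 1)⁻¹ * (gam σ k * ∑ α, trig k (node n α) * c α)) ^ 2 ≤
      (2 * (2 * n + 1) * ρ * S) *
        (if n < k.natAbs then (2 / 27) ^ (k.natAbs - n - 1) else 0) := fun k => by
    split_ifs with hk
    · obtain ⟨j, hj, θ, hθ, hα, e, he, hke⟩ := exists_alias n hk
      have hXk : ∑ α, trig k (node n α) * b α = θ * ∑ α, trig j (node n α) * b α := by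
        simp only [hα, Finset.mul_sum, mul_assoc]
      have hYk : ∑ α, trig k (node n α) * c α =
          θ * (((j : ℝ) ^ 2 + 1) * ∑ α, trig j (node n α) * b α) := by
        rw [← hbc j hj]
        simp only [hα, Finset.mul_sum, mul_assoc]
      rw [hXk, hYk]
      refine (alias_term_le hρ0 hρ hρ1 hk hθ he hke).trans ?_
      have hjS := sq_le_sum_mode (fun k => gam σ k * ∑ α, trig k (node n α) * b α)
        (hj.trans (by exact_mod_cast h))
      rw [hS] at hjS
      refine (mul_le_mul_of_nonneg_left hjS (by positivity)).trans (le_of_eq ?_)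
      ring
    · have : ((k : ℝ) ^ 2 + 1) ≠ 0 := by positivity
      rw [hbc k (by rw [abs_le]; omega), mul_left_comm (gam σ k), inv_mul_cancel_left₀ this]
      simp
  refine (Finset.sum_le_sum fun (k : Mode m) _ => hterm k).trans ?_
  obtain ⟨d', rfl⟩ : ∃ d', m = n + d' := ⟨m - n, by omega⟩
  rw [← Finset.mul_sum, Finset.sum_coe_sort (Finset.Icc (-((n + d' : ℕ) : ℤ)) ((n + d' : ℕ) : ℤ))
    fun k : ℤ => if n < k.natAbs then ((2 : ℝ) / 27) ^ (k.natAbs - n - 1) else 0]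
  refine (mul_le_mul_of_nonneg_left (sum_geometric_Icc_le n d' (by norm_num) (by norm_num))
    (by positivity)).trans (le_of_eq ?_)
  norm_num
  ring

theorem exists_residual_le {n m : ℕ} (h : n ≤ m) {σ ρ : ℝ} (hσ : σ ≠ 0) (hρ0 : 0 ≤ ρ)
    (hρ : exp (-((2 * n + 1) * σ ^ 2 / 2)) ≤ ρ) (hρ1 : ρ ≤ 1 / 27) (b : Constraint n) :
    ∃ c : Constraint n,
      (L m *ᵥ ((A m)⁻¹ *ᵥ (G n m σ *ᵥ b)) - (A m)⁻¹ *ᵥ (G n m σ *ᵥ c)) ⬝ᵥ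
          A m *ᵥ (L m *ᵥ ((A m)⁻¹ *ᵥ (G n m σ *ᵥ b)) - (A m)⁻¹ *ᵥ (G n m σ *ᵥ c)) ≤
        (4.32 * ((2 * n + 1) * ρ)) *
          (((A m)⁻¹ *ᵥ (G n m σ *ᵥ b)) ⬝ᵥ A m *ᵥ ((A m)⁻¹ *ᵥ (G n m σ *ᵥ b))) := by
  set b₂ : Fin (2 * n + 1) → ℝ := b ∘ Sum.inr with hb₂
  set X : ℤ → ℝ := fun k => ∑ α, trig k (node n α) * b₂ α with hX
  set d : Mode n → ℝ := fun j => (((j : ℤ) : ℝ) ^ 2 + 1) * X j with hd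
  set c₁ : Fin (2 * n + 1) → ℝ := ((2 * π / (2 * n + 1) : ℝ) • (nodeMatrix n)ᵀ) *ᵥ d with hc₁
  set Y : ℤ → ℝ := fun k => ∑ α, trig k (node n α) * c₁ α with hY
  have hYd : ∀ j : ℤ, |j| ≤ n → Y j = ((j : ℝ) ^ 2 + 1) * X j := fun j hj => by
    have h1 : nodeMatrix n *ᵥ c₁ = d := by
      rw [hc₁, Matrix.mulVec_mulVec, nodeMatrix_mul_transpose, Matrix.one_mulVec]
    exact congrFun h1 ⟨j, Finset.mem_Icc.2 (abs_le.1 hj)⟩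
  set S : ℝ := ∑ k : Mode m, (gam σ k * X k) ^ 2 with hS
  -- `L` exchanges the two fields. Its `π`-component is matched exactly by `-(b ∘ Sum.inl)`; in the
  -- `u`-component the factor `k² + 1` can be matched only for `|k| ≤ n`, which is what `c₁` does.
  refine ⟨Sum.elim c₁ (-(b ∘ Sum.inl)), ?_⟩
  have hy1 : ∀ (f : Constraint n) (k : Mode m), ((A m)⁻¹ *ᵥ (G n m σ *ᵥ f)) (Sum.inl k) =
      (((k : ℤ) : ℝ) ^ 2 + 1)⁻¹ * (G₀ n m σ *ᵥ (f ∘ Sum.inl)) k := fun f k => by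
    rw [A_inv, Matrix.mulVec_diagonal, G_mulVec]
    rfl
  have hy2 : ∀ (f : Constraint n) (k : Mode m), ((A m)⁻¹ *ᵥ (G n m σ *ᵥ f)) (Sum.inr k) =
      (G₀ n m σ *ᵥ (f ∘ Sum.inr)) k := fun f k => by
    rw [A_inv, Matrix.mulVec_diagonal, G_mulVec]
    simp
  have hL1 : ∀ (w : Mode m ⊕ Mode m → ℝ) k, (L m *ᵥ w) (Sum.inl k) = w (Sum.inr k) :=
    fun w k => by simp [L, Matrix.fromBlocks_mulVec]
  have hL2 : ∀ (w : Mode m ⊕ Mode m → ℝ) k,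
      (L m *ᵥ w) (Sum.inr k) = -((((k : ℤ) : ℝ) ^ 2 + 1) * w (Sum.inl k)) :=
    fun w k => by
      rw [L, Matrix.fromBlocks_mulVec]
      simp [LambdaSq, Matrix.mulVec_diagonal]
      ring
  -- `S` is the `π`-part of the energy.
  have hpart : S ≤ ((A m)⁻¹ *ᵥ (G n m σ *ᵥ b)) ⬝ᵥ A m *ᵥ ((A m)⁻¹ *ᵥ (G n m σ *ᵥ b)) := by
    rw [dotProduct_A_mulVec]
    refine le_add_of_nonneg_of_le (Finset.sum_nonneg fun k _ =>
      mul_nonneg (by positivity) (mul_self_nonneg _)) (le_of_eq ?_)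
    refine Finset.sum_congr rfl fun k _ => ?_
    rw [hy2, G₀_mulVec n m hσ, sq]
  refine le_trans ?_ (mul_le_mul_of_nonneg_left hpart (by positivity))
  rw [dotProduct_A_mulVec]
  have hzero : ∑ k : Mode m,
      (L m *ᵥ ((A m)⁻¹ *ᵥ (G n m σ *ᵥ b)) -
        (A m)⁻¹ *ᵥ (G n m σ *ᵥ Sum.elim c₁ (-(b ∘ Sum.inl)))) (Sum.inr k) *
      (L m *ᵥ ((A m)⁻¹ *ᵥ (G n m σ *ᵥ b)) -
        (A m)⁻¹ *ᵥ (G n m σ *ᵥ Sum.elim c₁ (-(b ∘ Sum.inl)))) (Sum.inr k) = 0 := by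
    refine Finset.sum_eq_zero fun k _ => ?_
    have : (((k : ℤ) : ℝ) ^ 2 + 1) ≠ 0 := by positivity
    rw [Pi.sub_apply, hL2, hy1, hy2, Sum.elim_comp_inr, Matrix.mulVec_neg, Pi.neg_apply,
      mul_inv_cancel_left₀ this, sub_self, zero_mul]
  rw [hzero, add_zero]
  rw [hS]
  refine le_trans (le_of_eq ?_) (sum_alias_le h hρ0 hρ hρ1 b₂ c₁ hYd)
  refine Finset.sum_congr rfl fun k _ => ?_
  rw [Pi.sub_apply, hL1, hy2, hy1, Sum.elim_comp_inl, G₀_mulVec n m hσ, G₀_mulVec n m hσ, ← sq]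

/-! ### Averages with respect to the Gibbs density -/

theorem continuous_gibbs_exponent (m : ℕ) :
    Continuous fun z : Phase m => z.ofLp ⬝ᵥ A m *ᵥ z.ofLp := by
  have h : Continuous fun z : Phase m => z.ofLp := PiLp.continuous_ofLp 2 _
  exact h.dotProduct (continuous_const.matrix_mulVec h)

theorem measurable_gibbs (m : ℕ) : Measurable (gibbs (m := m)) :=
  (ENNReal.continuous_ofReal.comp (continuous_exp.comp
    (continuous_const.mul (continuous_gibbs_exponent m)))).measurable

theorem toReal_gibbs {m : ℕ} (z : Phase m) :
    (gibbs z).toReal = exp (-(1 / 2) * (z.ofLp ⬝ᵥ A m *ᵥ z.ofLp)) :=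
  ENNReal.toReal_ofReal (exp_pos _).le

theorem integral_withDensity_gibbs {m : ℕ} (μ : Measure (Phase m)) (F : Phase m → ℝ) :
    ∫ z, F z ∂(μ.withDensity gibbs) =
      ∫ z, exp (-(1 / 2) * (z.ofLp ⬝ᵥ A m *ᵥ z.ofLp)) * F z ∂μ := by
  rw [integral_withDensity_eq_integral_toReal_smul (measurable_gibbs m)
    (Filter.Eventually.of_forall fun z => ENNReal.ofReal_lt_top)]
  simp only [toReal_gibbs, smul_eq_mul]

theorem withDensity_gibbs_real_univ {m : ℕ} (μ : Measure (Phase m)) :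
    (μ.withDensity gibbs).real Set.univ =
      ∫ z, exp (-(1 / 2) * (z.ofLp ⬝ᵥ A m *ᵥ z.ofLp)) ∂μ := by
  have h := integral_withDensity_gibbs μ fun _ => 1
  simpa using h

theorem integral_normalized_gibbs {m : ℕ} (μ : Measure (Phase m)) (F : Phase m → ℝ) :
    ∫ z, F z ∂(normalized (μ.withDensity gibbs)) =
      (∫ z, exp (-(1 / 2) * (z.ofLp ⬝ᵥ A m *ᵥ z.ofLp)) ∂μ)⁻¹ *
        ∫ z, exp (-(1 / 2) * (z.ofLp ⬝ᵥ A m *ᵥ z.ofLp)) * F z ∂μ := by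
  rw [normalized, integral_smul_measure, integral_withDensity_gibbs, ← withDensity_gibbs_real_univ,
    ENNReal.toReal_inv, smul_eq_mul]
  rfl

theorem norm_sq_le_energy {m : ℕ} (z : Phase m) : ‖z‖ ^ 2 ≤ z.ofLp ⬝ᵥ A m *ᵥ z.ofLp := by
  rw [EuclideanSpace.norm_sq_eq, Fintype.sum_sum_type, dotProduct_A_mulVec]
  refine add_le_add (Finset.sum_le_sum fun k _ => ?_) (Finset.sum_le_sum fun k _ => ?_)
  · rw [Real.norm_eq_abs, sq_abs]
    nlinarith [mul_nonneg (sq_nonneg ((k : ℤ) : ℝ)) (sq_nonneg (z.ofLp (Sum.inl k)))]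
  · rw [Real.norm_eq_abs, sq_abs, sq]

/-! ### The exact mean -/

/-- The directions along the affine subspaces `Gᵀ z = v`. -/
def fiberDirection (n m : ℕ) (σ : ℝ) : Submodule ℝ (Phase m) :=
  LinearMap.ker (Matrix.toLin' (G n m σ)ᵀ ∘ₗ (WithLp.linearEquiv 2 ℝ (Mode m ⊕ Mode m → ℝ)).toLinearMap)

theorem mem_fiberDirection {n m : ℕ} {σ : ℝ} {y : Phase m} :
    y ∈ fiberDirection n m σ ↔ (G n m σ)ᵀ *ᵥ y.ofLp = 0 := by
  rw [fiberDirection, LinearMap.mem_ker]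
  rfl

theorem finrank_fiberDirection (n m : ℕ) (σ : ℝ) :
    Module.finrank ℝ (fiberDirection n m σ) = fiberDim n m σ := by
  rw [fiberDirection, fiberDim, LinearMap.ker_comp, Submodule.comap_equiv_eq_map_symm]
  exact LinearEquiv.finrank_map_eq _ _

/-- The surface measure of an affine subspace `Gᵀ z = v` is Lebesgue measure on its direction. -/
theorem surfaceMeasure_eq_map (n m : ℕ) (σ : ℝ) {v : Constraint n} {w : Phase m}
    (hw : constraintOf n σ w = v) :
    (Measure.euclideanHausdorffMeasure (fiberDim n m σ)).restrict (fiber n m σ v) =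
      Measure.map (fun y : fiberDirection n m σ => w + (y : Phase m)) volume := by
  have hiso : Isometry (fun y : fiberDirection n m σ => w + (y : Phase m)) :=
    (isometry_add_left w).comp isometry_subtype_coe
  have hrange : Set.range (fun y : fiberDirection n m σ => w + (y : Phase m)) = fiber n m σ v := by
    ext z
    constructor
    · rintro ⟨y, rfl⟩
      have hy := mem_fiberDirection.1 y.2
      change (G n m σ)ᵀ *ᵥ (w.ofLp + (y : Phase m).ofLp) = v
      rw [Matrix.mulVec_add, hy, add_zero]
      exact hw
    · intro hz
      refine ⟨⟨z - w, mem_fiberDirection.2 ?_⟩, add_sub_cancel w z⟩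
      have hz' : (G n m σ)ᵀ *ᵥ z.ofLp = v := hz
      have hw' : (G n m σ)ᵀ *ᵥ w.ofLp = v := hw
      rw [WithLp.ofLp_sub, Matrix.mulVec_sub, hz', hw', sub_self]
  -- An isometry carries Hausdorff measure to its restriction to the range, and in the full
  -- dimension of an inner product space this measure is Lebesgue measure.
  rw [← hrange, ← hiso.map_euclideanHausdorffMeasure, ← finrank_fiberDirection,
    InnerProductSpace.euclideanHausdorffMeasure_eq_volume]

theorem integrable_exp_neg_mul_sq_norm {V : Type*} [NormedAddCommGroup V] [InnerProductSpace ℝ V]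
    [FiniteDimensional ℝ V] [MeasurableSpace V] [BorelSpace V] {b : ℝ} (hb : 0 < b) :
    Integrable fun y : V => exp (-b * ‖y‖ ^ 2) := by
  have h := (GaussianFourier.integrable_cexp_neg_mul_sq_norm_add (V := V) (b := b)
    (by simpa using hb) 0 0).norm
  refine h.congr (Filter.Eventually.of_forall fun y => ?_)
  simp only [Complex.norm_exp]
  congr 1
  have : -(b : ℂ) * (‖y‖ : ℂ) ^ 2 + 0 * ((inner ℝ (0 : V) y : ℝ) : ℂ) =
      ((-b * ‖y‖ ^ 2 : ℝ) : ℂ) := by push_cast; ring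
  rw [this, Complex.ofReal_re]

theorem integrable_gibbs_fiberDirection (n m : ℕ) (σ : ℝ) :
    Integrable fun y : fiberDirection n m σ =>
      exp (-(1 / 2) * ((y : Phase m).ofLp ⬝ᵥ A m *ᵥ (y : Phase m).ofLp)) := by
  refine (integrable_exp_neg_mul_sq_norm (b := 1 / 2) one_half_pos).mono'
    (continuous_exp.comp (continuous_const.mul
      ((continuous_gibbs_exponent m).comp continuous_subtype_val))).aestronglyMeasurable
    (Filter.Eventually.of_forall fun y => ?_)
  rw [Real.norm_eq_abs, abs_exp, exp_le_exp]
  have := norm_sq_le_energy (y : Phase m)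
  rw [Submodule.norm_coe] at this
  linarith

theorem integrable_gibbs_mul_fiberDirection (n m : ℕ) (σ : ℝ) (l : Phase m →L[ℝ] ℝ) :
    Integrable fun y : fiberDirection n m σ =>
      exp (-(1 / 2) * ((y : Phase m).ofLp ⬝ᵥ A m *ᵥ (y : Phase m).ofLp)) * l y := by
  refine ((integrable_exp_neg_mul_sq_norm (b := 1 / 4) (by norm_num)).mul_const
      (2 * ‖l‖)).mono'
    ((continuous_exp.comp (continuous_const.mul
      ((continuous_gibbs_exponent m).comp continuous_subtype_val))).mul
        (l.continuous.comp continuous_subtype_val)).aestronglyMeasurable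
    (Filter.Eventually.of_forall fun y => ?_)
  have h1 := norm_sq_le_energy (y : Phase m)
  have h2 := l.le_opNorm (y : Phase m)
  rw [Submodule.norm_coe] at h1 h2
  -- Half of the Gaussian decay absorbs the linear growth of `l`.
  have h3 : ‖y‖ ≤ 2 * exp (1 / 4 * ‖y‖ ^ 2) := by
    have := add_one_le_exp (1 / 4 * ‖y‖ ^ 2)
    nlinarith [sq_nonneg (‖y‖ - 1)]
  rw [norm_mul, Real.norm_eq_abs, abs_exp]
  calc exp (-(1 / 2) * ((y : Phase m).ofLp ⬝ᵥ A m *ᵥ (y : Phase m).ofLp)) * ‖l y‖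
      ≤ exp (-(1 / 2) * ‖y‖ ^ 2) * (‖l‖ * (2 * exp (1 / 4 * ‖y‖ ^ 2))) := by
        refine mul_le_mul (exp_le_exp.2 (by linarith)) ?_ (norm_nonneg _) (exp_pos _).le
        exact h2.trans (mul_le_mul_of_nonneg_left h3 (norm_nonneg _))
    _ = exp (-(1 / 2) * ‖y‖ ^ 2) * exp (1 / 4 * ‖y‖ ^ 2) * (2 * ‖l‖) := by ring
    _ = exp (-(1 / 4) * ‖y‖ ^ 2) * (2 * ‖l‖) := by
        rw [← exp_add]
        ring_nf

/-- The mean of a linear functional over the constrained initial data is its value at the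
reconstructed state. -/
theorem integral_restrictedP {n m : ℕ} (h : n ≤ m) {σ : ℝ} (hσ : σ ≠ 0) (v : Constraint n)
    (l : Phase m →L[ℝ] ℝ) :
    ∫ z, l z ∂(restrictedP n m σ v) = l (WithLp.toLp 2 (reconstruct (A m) (G n m σ) *ᵥ v)) := by
  set w : Phase m := WithLp.toLp 2 (reconstruct (A m) (G n m σ) *ᵥ v) with hw
  have hAu : IsUnit (A m).det := (A_posDef m).det_pos.ne'.isUnit
  have hwv : constraintOf n σ w = v := by
    change (G n m σ)ᵀ *ᵥ (reconstruct (A m) (G n m σ) *ᵥ v) = v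
    rw [Matrix.mulVec_mulVec, transpose_mul_reconstruct (isUnit_det_M h hσ), Matrix.one_mulVec]
  have hiso : Isometry (fun y : fiberDirection n m σ => w + (y : Phase m)) :=
    (isometry_add_left w).comp isometry_subtype_coe
  have hmap : ∀ F : Phase m → ℝ,
      ∫ z, F z ∂(Measure.map (fun y : fiberDirection n m σ => w + (y : Phase m)) volume) =
        ∫ y : fiberDirection n m σ, F (w + y) := fun F =>
    hiso.isClosedEmbedding.measurableEmbedding.integral_map F
  -- The cross term vanishes by orthogonality, so the density on the fiber is a constant times an
  -- even function of `y`.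
  have hexp : ∀ y : fiberDirection n m σ,
      exp (-(1 / 2) * ((w + (y : Phase m)).ofLp ⬝ᵥ A m *ᵥ (w + (y : Phase m)).ofLp)) =
        exp (-(1 / 2) * (w.ofLp ⬝ᵥ A m *ᵥ w.ofLp)) *
          exp (-(1 / 2) * ((y : Phase m).ofLp ⬝ᵥ A m *ᵥ (y : Phase m).ofLp)) := fun y => by
    have h0 : w.ofLp ⬝ᵥ A m *ᵥ (y : Phase m).ofLp = 0 := by
      change (reconstruct (A m) (G n m σ) *ᵥ v) ⬝ᵥ _ = 0
      rw [reconstruct_dotProduct (A_transpose m) hAu, mem_fiberDirection.1 y.2, Matrix.mulVec_zero,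
        dotProduct_zero]
    rw [← exp_add, WithLp.ofLp_add, Matrix.mulVec_add, add_dotProduct, dotProduct_add,
      dotProduct_add, dotProduct_mulVec_comm (A_transpose m) (y : Phase m).ofLp w.ofLp, h0]
    congr 1
    ring
  have hodd : ∫ y : fiberDirection n m σ,
      exp (-(1 / 2) * ((y : Phase m).ofLp ⬝ᵥ A m *ᵥ (y : Phase m).ofLp)) * l y = 0 := by
    have h1 := (LinearIsometryEquiv.neg ℝ (E := fiberDirection n m σ)).measurePreserving.integral_comp
      (LinearIsometryEquiv.neg ℝ).toHomeomorph.measurableEmbedding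
      (fun y => exp (-(1 / 2) * ((y : Phase m).ofLp ⬝ᵥ A m *ᵥ (y : Phase m).ofLp)) * l y)
    simp only [LinearIsometryEquiv.coe_neg, Submodule.coe_neg, WithLp.ofLp_neg, Matrix.mulVec_neg, neg_dotProduct,
      dotProduct_neg, neg_neg, map_neg, mul_neg, integral_neg] at h1
    linarith
  have hI := integral_exp_pos (integrable_gibbs_fiberDirection n m σ)
  rw [restrictedP, surfaceMeasure_eq_map n m σ hwv, integral_normalized_gibbs, hmap, hmap]
  simp_rw [hexp, map_add, mul_assoc, mul_add]
  rw [integral_const_mul, integral_add (((integrable_gibbs_fiberDirection n m σ).mul_const _).const_mul _)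
    ((integrable_gibbs_mul_fiberDirection n m σ l).const_mul _), integral_const_mul,
    integral_const_mul, hodd, integral_mul_const, mul_zero, add_zero]
  have hE := exp_pos (-(1 / 2) * (w.ofLp ⬝ᵥ A m *ᵥ w.ofLp))
  rw [← mul_assoc (exp _), inv_mul_cancel_left₀]
  exact (mul_pos hE hI).ne'

/-- The flow followed by evaluation at a point is a linear functional of the initial data. -/
theorem exactMean_eq {n m : ℕ} (h : n ≤ m) {σ : ℝ} (hσ : σ ≠ 0) (v : Constraint n) (t : ℝ) :
    exactMean n m σ v t =
      toFields (flow t (WithLp.toLp 2 (reconstruct (A m) (G n m σ) *ᵥ v) : Phase m)) := by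
  have hflow : ∀ f : Phase m →ₗ[ℝ] ℝ, ∫ z, f (flow t z) ∂(restrictedP n m σ v) =
      f (flow t (WithLp.toLp 2 (reconstruct (A m) (G n m σ) *ᵥ v) : Phase m)) := fun f => by
    let S : Phase m →ₗ[ℝ] Phase m :=
      { toFun := flow t
        map_add' := fun z w => by simp [flow, Matrix.mulVec_add]
        map_smul' := fun c z => by simp [flow, Matrix.mulVec_smul] }
    exact integral_restrictedP h hσ v (f ∘ₗ S).toContinuousLinearMap
  refine Prod.ext (funext fun x => ?_) (funext fun x => ?_)
  · exact hflow
      { toFun := fun z => (toFields z).1 x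
        map_add' := fun z w => by simp [toFields, add_mul, Finset.sum_add_distrib]
        map_smul' := fun c z => by simp [toFields, Finset.mul_sum, mul_assoc] }
  · exact hflow
      { toFun := fun z => (toFields z).2 x
        map_add' := fun z w => by simp [toFields, add_mul, Finset.sum_add_distrib]
        map_smul' := fun c z => by simp [toFields, Finset.mul_sum, mul_assoc] }

/-! ### Second moments of Gaussian measures -/

theorem hasDerivAt_exp_neg_mul_sq (b x : ℝ) :
    HasDerivAt (fun x : ℝ => exp (-b * x ^ 2)) (-(2 * b) * (x * exp (-b * x ^ 2))) x := by
  have h := (((hasDerivAt_id x).pow 2).const_mul (-b)).exp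
  refine h.congr_deriv ?_
  simp
  ring

theorem integrable_sq_mul_exp_neg_mul_sq {b : ℝ} (hb : 0 < b) :
    Integrable fun x : ℝ => x ^ 2 * exp (-b * x ^ 2) := by
  simpa using integrable_rpow_mul_exp_neg_mul_sq hb (s := 2) (by norm_num)

theorem integral_mul_exp_neg_mul_sq {b : ℝ} (hb : 0 < b) :
    ∫ x : ℝ, x * exp (-b * x ^ 2) = 0 := by
  have h := integral_eq_zero_of_hasDerivAt_of_integrable (hasDerivAt_exp_neg_mul_sq b)
    ((integrable_mul_exp_neg_mul_sq hb).const_mul _) (integrable_exp_neg_mul_sq hb)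
  rw [integral_const_mul] at h
  exact (mul_eq_zero.1 h).resolve_left (by linarith)

/-- Integration by parts: the derivative of `x * exp (-b * x ^ 2)` has integral zero. -/
theorem integral_sq_mul_exp_neg_mul_sq {b : ℝ} (hb : 0 < b) :
    ∫ x : ℝ, x ^ 2 * exp (-b * x ^ 2) = (2 * b)⁻¹ * ∫ x : ℝ, exp (-b * x ^ 2) := by
  have hd : ∀ x : ℝ, HasDerivAt (fun x : ℝ => x * exp (-b * x ^ 2))
      (exp (-b * x ^ 2) - 2 * b * (x ^ 2 * exp (-b * x ^ 2))) x := fun x => by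
    refine ((hasDerivAt_id x).mul (hasDerivAt_exp_neg_mul_sq b x)).congr_deriv ?_
    simp only [id]
    ring
  have h := integral_eq_zero_of_hasDerivAt_of_integrable hd
    ((integrable_exp_neg_mul_sq hb).sub ((integrable_sq_mul_exp_neg_mul_sq hb).const_mul _))
    (integrable_mul_exp_neg_mul_sq hb)
  rw [integral_sub (integrable_exp_neg_mul_sq hb)
    ((integrable_sq_mul_exp_neg_mul_sq hb).const_mul _), integral_const_mul, sub_eq_zero] at h
  rw [h, inv_mul_cancel_left₀ (by positivity)]

theorem integral_exp_neg_sum {ι : Type*} [Fintype ι] (b : ι → ℝ) :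
    ∫ z : ι → ℝ, exp (-∑ k, b k * z k ^ 2) = ∏ k, ∫ x : ℝ, exp (-b k * x ^ 2) := by
  rw [← integral_fintype_prod_volume_eq_prod]
  simp only [← Finset.sum_neg_distrib, exp_sum, neg_mul]

section Moments

variable {ι : Type*} [Fintype ι] [DecidableEq ι]

/-- A product over coordinates reduces the second moments to one-dimensional integrals. -/
theorem mul_exp_neg_sum_eq_prod (b : ι → ℝ) (i j : ι) (z : ι → ℝ) :
    z i * z j * exp (-∑ k, b k * z k ^ 2) =
      ∏ k, (if k = i then z k else 1) * (if k = j then z k else 1) * exp (-b k * z k ^ 2) := by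
  rw [Finset.prod_mul_distrib, Finset.prod_mul_distrib, Finset.prod_ite_eq', Finset.prod_ite_eq',
    if_pos (Finset.mem_univ _), if_pos (Finset.mem_univ _), ← Finset.sum_neg_distrib, exp_sum]
  simp only [neg_mul]

theorem integrable_mul_exp_neg_sum {b : ι → ℝ} (hb : ∀ k, 0 < b k) (i j : ι) :
    Integrable fun z : ι → ℝ => z i * z j * exp (-∑ k, b k * z k ^ 2) := by
  simp_rw [mul_exp_neg_sum_eq_prod]
  refine Integrable.fintype_prod (μ := fun _ => volume) (f := fun k x =>
    (if k = i then x else 1) * (if k = j then x else 1) * exp (-b k * x ^ 2)) fun k => ?_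
  split_ifs
  · simpa only [sq] using integrable_sq_mul_exp_neg_mul_sq (hb k)
  · simpa only [mul_one] using integrable_mul_exp_neg_mul_sq (hb k)
  · simpa only [one_mul] using integrable_mul_exp_neg_mul_sq (hb k)
  · simpa only [one_mul] using integrable_exp_neg_mul_sq (hb k)

theorem integral_mul_exp_neg_sum {b : ι → ℝ} (hb : ∀ k, 0 < b k) (i j : ι) :
    ∫ z : ι → ℝ, z i * z j * exp (-∑ k, b k * z k ^ 2) =
      if i = j then (2 * b i)⁻¹ * ∫ z : ι → ℝ, exp (-∑ k, b k * z k ^ 2) else 0 := by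
  simp_rw [mul_exp_neg_sum_eq_prod]
  rw [integral_fintype_prod_volume_eq_prod (f := fun k (x : ℝ) =>
    (if k = i then x else 1) * (if k = j then x else 1) * exp (-b k * x ^ 2))]
  split_ifs with hij
  · subst hij
    have h : ∀ k, ∫ x : ℝ, (if k = i then x else 1) * (if k = i then x else 1) *
        exp (-b k * x ^ 2) = (if k = i then (2 * b k)⁻¹ else 1) * ∫ x : ℝ, exp (-b k * x ^ 2) :=
      fun k => by
        split_ifs
        · rw [← integral_sq_mul_exp_neg_mul_sq (hb k)]
          simp only [sq]
        · simp only [one_mul]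
    simp_rw [h]
    rw [Finset.prod_mul_distrib, Finset.prod_ite_eq', if_pos (Finset.mem_univ _),
      integral_exp_neg_sum]
  · refine Finset.prod_eq_zero (Finset.mem_univ i) ?_
    simp only [if_true, hij, if_false, mul_one]
    exact integral_mul_exp_neg_mul_sq (hb i)

end Moments

/-- Half the diagonal of the energy matrix. -/
def halfDiag (m : ℕ) : Mode m ⊕ Mode m → ℝ :=
  fun i => 1 / 2 * Sum.elim (fun k : Mode m => ((k : ℤ) : ℝ) ^ 2 + 1) (fun _ => 1) i

theorem halfDiag_pos {m : ℕ} (i : Mode m ⊕ Mode m) : 0 < halfDiag m i := by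
  rcases i with k | k <;> simp only [halfDiag, Sum.elim_inl, Sum.elim_inr] <;> positivity

theorem half_energy_eq {m : ℕ} (z : Mode m ⊕ Mode m → ℝ) :
    -(1 / 2) * (z ⬝ᵥ A m *ᵥ z) = -∑ i, halfDiag m i * z i ^ 2 := by
  rw [A_eq_diagonal, dotProduct, Finset.mul_sum, ← Finset.sum_neg_distrib]
  refine Finset.sum_congr rfl fun i _ => ?_
  rw [Matrix.mulVec_diagonal, halfDiag]
  ring

theorem A_inv_apply {m : ℕ} (i j : Mode m ⊕ Mode m) :
    (A m)⁻¹ i j = if i = j then (2 * halfDiag m i)⁻¹ else 0 := by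
  rw [A_inv, Matrix.diagonal_apply]
  congr 1
  rcases i with k | k <;> simp [halfDiag]

theorem integral_phase {m : ℕ} (F : (Mode m ⊕ Mode m → ℝ) → ℝ) :
    ∫ z : Phase m, F z.ofLp = ∫ z, F z :=
  (PiLp.volume_preserving_ofLp (Mode m ⊕ Mode m)).integral_comp
    (MeasurableEquiv.toLp 2 (Mode m ⊕ Mode m → ℝ)).symm.measurableEmbedding F

theorem integrable_phase {m : ℕ} {F : (Mode m ⊕ Mode m → ℝ) → ℝ} (hF : Integrable F) :
    Integrable fun z : Phase m => F z.ofLp :=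
  ((PiLp.volume_preserving_ofLp (Mode m ⊕ Mode m)).integrable_comp_emb
    (MeasurableEquiv.toLp 2 (Mode m ⊕ Mode m → ℝ)).symm.measurableEmbedding).2 hF

theorem integral_gibbs_pos (m : ℕ) :
    0 < ∫ z : Phase m, exp (-(1 / 2) * (z.ofLp ⬝ᵥ A m *ᵥ z.ofLp)) := by
  simp_rw [half_energy_eq]
  rw [integral_phase fun z => exp (-∑ i, halfDiag m i * z i ^ 2), integral_exp_neg_sum]
  exact Finset.prod_pos fun i _ => integral_exp_pos (integrable_exp_neg_mul_sq (halfDiag_pos i))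

theorem withDensity_gibbs_univ_ne (m : ℕ) :
    (volume : Measure (Phase m)).withDensity gibbs Set.univ ≠ 0 ∧
      (volume : Measure (Phase m)).withDensity gibbs Set.univ ≠ ⊤ := by
  have h := integral_gibbs_pos m
  rw [← withDensity_gibbs_real_univ, measureReal_def, ENNReal.toReal_pos_iff] at h
  exact ⟨h.1.ne', h.2.ne⟩

instance isProbabilityMeasure_P (m : ℕ) : IsProbabilityMeasure (P m) :=
  ⟨ENNReal.inv_mul_cancel (withDensity_gibbs_univ_ne m).1 (withDensity_gibbs_univ_ne m).2⟩

theorem integrable_mul_P {m : ℕ} (i j : Mode m ⊕ Mode m) :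
    Integrable (fun z : Phase m => z i * z j) (P m) := by
  refine Integrable.smul_measure ?_ (ENNReal.inv_ne_top.2 (withDensity_gibbs_univ_ne m).1)
  rw [integrable_withDensity_iff_integrable_smul' (measurable_gibbs m)
    (Filter.Eventually.of_forall fun z => ENNReal.ofReal_lt_top)]
  simp only [toReal_gibbs, half_energy_eq, smul_eq_mul]
  refine (integrable_phase (integrable_mul_exp_neg_sum (b := halfDiag m) halfDiag_pos i j)).congr
    (Filter.Eventually.of_forall fun z => mul_comm _ _)

/-- The covariance matrix of `P` is `A⁻¹`. -/
theorem integral_mul_P {m : ℕ} (i j : Mode m ⊕ Mode m) :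
    ∫ z : Phase m, z i * z j ∂(P m) = (A m)⁻¹ i j := by
  have hpos := integral_gibbs_pos m
  rw [P, integral_normalized_gibbs]
  simp only [half_energy_eq] at hpos ⊢
  simp_rw [mul_comm (exp _)]
  rw [integral_phase fun z => exp (-∑ i, halfDiag m i * z i ^ 2)] at hpos ⊢
  rw [integral_phase fun z => z i * z j * exp (-∑ k, halfDiag m k * z k ^ 2),
    integral_mul_exp_neg_sum halfDiag_pos, A_inv_apply]
  split_ifs
  · rw [mul_left_comm, inv_mul_cancel₀ hpos.ne', mul_one]
  · rw [mul_zero]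

theorem integrable_quadratic_P {m : ℕ} (S : Matrix (Mode m ⊕ Mode m) (Mode m ⊕ Mode m) ℝ) :
    Integrable (fun z : Phase m => z.ofLp ⬝ᵥ S *ᵥ z.ofLp) (P m) := by
  simp only [dotProduct, Matrix.mulVec, Finset.mul_sum]
  refine integrable_finsetSum _ fun i _ => integrable_finsetSum _ fun j _ => ?_
  refine ((integrable_mul_P i j).const_mul (S i j)).congr
    (Filter.Eventually.of_forall fun z => ?_)
  ring

theorem integral_quadratic_P {m : ℕ} (S : Matrix (Mode m ⊕ Mode m) (Mode m ⊕ Mode m) ℝ) :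
    ∫ z : Phase m, z.ofLp ⬝ᵥ S *ᵥ z.ofLp ∂(P m) = (S * (A m)⁻¹).trace := by
  have hint : ∀ i j, Integrable (fun z : Phase m => z i * (S i j * z j)) (P m) := fun i j =>
    ((integrable_mul_P i j).const_mul (S i j)).congr
      (Filter.Eventually.of_forall fun z => by ring)
  simp only [dotProduct, Matrix.mulVec, Finset.mul_sum, Matrix.trace, Matrix.diag, Matrix.mul_apply]
  rw [integral_finsetSum _ fun i _ => integrable_finsetSum _ fun j _ => hint i j]
  refine Finset.sum_congr rfl fun i _ => ?_
  rw [integral_finsetSum _ fun j _ => hint i j]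
  refine Finset.sum_congr rfl fun j _ => ?_
  simp_rw [mul_left_comm _ (S i j)]
  rw [integral_const_mul, integral_mul_P, A_inv_apply, A_inv_apply]
  simp only [eq_comm (a := i)]
  split_ifs with h
  · rw [h]
  · rfl

/-- The energy of the reconstruction is a quadratic form whose expectation is the number of
constraints. -/
theorem exists_quadratic_eq_energy_reconstruct {n m : ℕ} (h : n ≤ m) {σ : ℝ} (hσ : σ ≠ 0) :
    ∃ S : Matrix (Mode m ⊕ Mode m) (Mode m ⊕ Mode m) ℝ,
      (∀ z : Phase m, (reconstruct (A m) (G n m σ) *ᵥ constraintOf n σ z) ⬝ᵥ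
        A m *ᵥ (reconstruct (A m) (G n m σ) *ᵥ constraintOf n σ z) = z.ofLp ⬝ᵥ S *ᵥ z.ofLp) ∧
      (S * (A m)⁻¹).trace = 2 * (2 * n + 1) := by
  have hM := isUnit_det_M (n := n) h hσ
  -- By cyclicity the trace of `G M⁻¹ Gᵀ A⁻¹` is that of `M⁻¹ M`, the identity on the constraints.
  refine ⟨G n m σ * ((G n m σ)ᵀ * (A m)⁻¹ * G n m σ)⁻¹ * (G n m σ)ᵀ, fun z => ?_, ?_⟩
  · rw [reconstruct_dotProduct (A_transpose m) (A_posDef m).det_pos.ne'.isUnit,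
      Matrix.mulVec_mulVec _ (G n m σ)ᵀ (reconstruct _ _), transpose_mul_reconstruct hM,
      Matrix.one_mulVec, constraintOf]
    rw [← Matrix.mulVec_mulVec, ← Matrix.mulVec_mulVec, Matrix.dotProduct_mulVec z.ofLp,
      Matrix.mulVec_transpose]
  · rw [Matrix.mul_assoc, Matrix.mul_assoc, Matrix.trace_mul_comm, Matrix.mul_assoc,
      Matrix.nonsing_inv_mul _ hM, Matrix.trace_one, Fintype.card_sum, Fintype.card_fin]
    push_cast
    ring

/-- Markov's inequality for the energy of the reconstruction. -/
theorem P_real_energy_reconstruct_ge {n m : ℕ} (h : n ≤ m) {σ : ℝ} (hσ : σ ≠ 0) {R : ℝ}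
    (hR : 0 < R) :
    (P m).real {z : Phase m | R ≤ (reconstruct (A m) (G n m σ) *ᵥ constraintOf n σ z) ⬝ᵥ
      A m *ᵥ (reconstruct (A m) (G n m σ) *ᵥ constraintOf n σ z)} ≤ 2 * (2 * n + 1) / R := by
  obtain ⟨S, hS, htr⟩ := exists_quadratic_eq_energy_reconstruct (n := n) h hσ
  have hM := mul_meas_ge_le_integral_of_nonneg (μ := P m)
    (f := fun z : Phase m => z.ofLp ⬝ᵥ S *ᵥ z.ofLp)
    (Filter.Eventually.of_forall fun z => by
      change 0 ≤ z.ofLp ⬝ᵥ S *ᵥ z.ofLp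
      rw [← hS]; exact A_nonneg _) (integrable_quadratic_P S) R
  rw [integral_quadratic_P, htr] at hM
  simp_rw [hS]
  rwa [le_div_iff₀' hR]

/-! ### The error of the approximate mean -/

theorem energyNorm_error_le {n m : ℕ} (h : n ≤ m) {σ ρ : ℝ} (hσ : σ ≠ 0) (hρ0 : 0 ≤ ρ)
    (hρ : exp (-((2 * n + 1) * σ ^ 2 / 2)) ≤ ρ) (hρ1 : ρ ≤ 1 / 27) (v : Constraint n) {t : ℝ}
    (ht : 0 ≤ t) :
    energyNorm (exactMean n m σ v t - approxMean n m σ v t) ≤ t * √(4.32 * ((2 * n + 1) * ρ)) *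
      √((reconstruct (A m) (G n m σ) *ᵥ v) ⬝ᵥ A m *ᵥ (reconstruct (A m) (G n m σ) *ᵥ v)) := by
  rw [exactMean_eq h hσ, approxMean, ← toFields_sub, energyNorm_toFields]
  refine galerkin_error (A_transpose m) A_nonneg (A_posDef m).det_pos.ne'.isUnit
    (isUnit_det_M h hσ) (A_mul_L m) (sqrt_nonneg _) (fun b => ?_) v ht
  rw [sq_sqrt (by positivity)]
  exact exists_residual_le h hσ hρ0 hρ hρ1 b

theorem exp_neg_le_rpow {n : ℕ} {σ ν : ℝ}
    (hσ : 6 * (ν + 1) * Real.log (2 * n + 1) ≤ (2 * n + 1) * σ ^ 2) :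
    exp (-((2 * n + 1) * σ ^ 2 / 2)) ≤ (2 * n + 1 : ℝ) ^ (-3 * (ν + 1)) := by
  rw [rpow_def_of_pos (by positivity), exp_le_exp]
  linarith

theorem rpow_le_one_div_27 {N ν : ℝ} (hN : 3 ≤ N) (hν : 0 < ν) : N ^ (-3 * (ν + 1)) ≤ 1 / 27 := by
  calc N ^ (-3 * (ν + 1)) ≤ N ^ (-3 : ℝ) := rpow_le_rpow_of_exponent_le (by linarith) (by linarith)
    _ ≤ (3 : ℝ) ^ (-3 : ℝ) := rpow_le_rpow_of_nonpos (by norm_num) hN (by norm_num)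
    _ = 1 / 27 := by rw [rpow_neg (by norm_num)]; norm_num

/-- The powers combine to `12.96 · N⁻¹ · N^{-2ν}`, and `12.96 / 3 = 4.32 ≤ 5.29 = 2.3²`. -/
theorem sqrt_mul_sqrt_le {N ν E : ℝ} (hN : 3 ≤ N) (hE : E ≤ 3 * N ^ (1 + ν)) :
    √(4.32 * (N * N ^ (-3 * (ν + 1)))) * √E ≤ 2.3 / N ^ ν := by
  have hN0 : 0 < N := by linarith
  have hp : 0 < N ^ ν := rpow_pos_of_pos hN0 ν
  have h1 : N ^ (1 + ν) = N * N ^ ν := by rw [rpow_add hN0, rpow_one]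
  have h2 : N ^ (-3 * (ν + 1)) = ((N * N ^ ν) ^ 3)⁻¹ := by
    rw [← h1, ← rpow_natCast, ← rpow_mul hN0.le, ← rpow_neg hN0.le]
    congr 1
    push_cast
    ring
  rw [← sqrt_mul (by positivity)]
  refine sqrt_le_iff.2 ⟨by positivity, ?_⟩
  calc 4.32 * (N * N ^ (-3 * (ν + 1))) * E
      ≤ 4.32 * (N * N ^ (-3 * (ν + 1))) * (3 * N ^ (1 + ν)) := by gcongr
    _ = 12.96 / N * (1 / N ^ ν) ^ 2 := by
      rw [h1, h2]
      field_simp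
      norm_num
    _ ≤ 5.29 * (1 / N ^ ν) ^ 2 := by
      gcongr
      rw [div_le_iff₀ hN0]
      linarith
    _ = (2.3 / N ^ ν) ^ 2 := by ring

end

end KleinGordon

theorem theorem1 (n r m : ℕ) (hn : 1 ≤ n) (hm : m = n + r * (2 * n + 1)) (σ ν : ℝ) (hν : 0 < ν)
    (hσ : 6 * (ν + 1) * Real.log (2 * n + 1) ≤ (2 * n + 1) * σ ^ 2) (t : ℝ) (ht : 0 ≤ t) :
    1 - (2 * n + 1 : ℝ) ^ (-ν) <
      (KleinGordon.P m).real {z : KleinGordon.Phase m |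
        KleinGordon.energyNorm
          (KleinGordon.exactMean n m σ (KleinGordon.constraintOf n σ z) t
            - KleinGordon.approxMean n m σ (KleinGordon.constraintOf n σ z) t)
          ≤ 2.3 * t / (2 * n + 1 : ℝ) ^ ν} := by
  have hnm : n ≤ m := hm ▸ Nat.le_add_right _ _
  have hN : (3 : ℝ) ≤ 2 * n + 1 := by
    have : (1 : ℝ) ≤ n := by exact_mod_cast hn
    linarith
  have hN0 : (0 : ℝ) < 2 * n + 1 := by linarith
  have hσ0 : σ ≠ 0 := by
    rintro rfl
    have := Real.log_pos (show (1 : ℝ) < 2 * n + 1 by linarith)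
    have : 0 < 6 * (ν + 1) * Real.log (2 * n + 1) := by positivity
    linarith
  have hp : 0 < (2 * n + 1 : ℝ) ^ ν := rpow_pos_of_pos hN0 ν
  -- With this threshold Markov's bound is `2/3` of `(2n+1)^{-ν}`, which makes the final inequality
  -- strict.
  have hR : 0 < 3 * (2 * n + 1 : ℝ) ^ (1 + ν) := by positivity
  have hbad := KleinGordon.P_real_energy_reconstruct_ge hnm hσ0 hR
  have hlt : 2 * (2 * n + 1) / (3 * (2 * n + 1 : ℝ) ^ (1 + ν)) < (2 * n + 1 : ℝ) ^ (-ν) := by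
    rw [rpow_add hN0, rpow_one, rpow_neg hN0.le, div_lt_iff₀ (by positivity)]
    field_simp
    norm_num
  set good : Set (KleinGordon.Phase m) := {z | KleinGordon.energyNorm
    (KleinGordon.exactMean n m σ (KleinGordon.constraintOf n σ z) t
      - KleinGordon.approxMean n m σ (KleinGordon.constraintOf n σ z) t)
    ≤ 2.3 * t / (2 * n + 1 : ℝ) ^ ν}
  set bad : Set (KleinGordon.Phase m) := {z | 3 * (2 * n + 1 : ℝ) ^ (1 + ν) ≤
    (KleinGordon.reconstruct (KleinGordon.A m) (KleinGordon.G n m σ) *ᵥ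
      KleinGordon.constraintOf n σ z) ⬝ᵥ KleinGordon.A m *ᵥ
    (KleinGordon.reconstruct (KleinGordon.A m) (KleinGordon.G n m σ) *ᵥ
      KleinGordon.constraintOf n σ z)}
  -- Covering the space and using subadditivity avoids any question of measurability of `good`.
  have hcover : Set.univ ⊆ good ∪ bad := fun z _ => by
    refine (le_or_gt (3 * (2 * n + 1 : ℝ) ^ (1 + ν)) _).symm.imp (fun hz => ?_) id
    refine (KleinGordon.energyNorm_error_le hnm hσ0 (by positivity)
      (KleinGordon.exp_neg_le_rpow hσ) (KleinGordon.rpow_le_one_div_27 hN hν) _ ht).trans ?_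
    rw [mul_assoc, mul_comm 2.3 t, mul_div_assoc]
    exact mul_le_mul_of_nonneg_left (KleinGordon.sqrt_mul_sqrt_le hN hz.le) ht
  have hone : 1 ≤ (KleinGordon.P m).real good + (KleinGordon.P m).real bad := by
    rw [← probReal_univ (μ := KleinGordon.P m)]
    exact (measureReal_mono hcover).trans (measureReal_union_le _ _)
  linarith
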